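/- A polynomial knot is a smooth embedding $\kappa=(x,y,z):\mathbb R\to\mathbb R^3$ whose components are polynomials, and its degree $d$ is the maximum of the degrees of $x,y,z$. Let $\bar\kappa:S^1=\mathbb R\cup\{\infty\}\to\mathbb R^3\cup\{\infty\}=S^3$ be its one-point compactification. Two knots $\alpha_0,\alpha_1:S^1\to S^3$ have the same knot type if $\alpha_0=g\circ\alpha_1\circ f$ for orientation-preserving homeomorphisms $f$ of $S^1$ and $g$ of $S^3$. The crossing number $c$ of $\kappa$ is the least number of crossings in a regular planar projection of a knot $K\subset\mathbb R^3\subset S^3$ with the same knot type as $\bar\kappa$, where a projection is regular if it has only finitely many multiple points, all of them transverse double points (the crossings). Then every polynomial knot $\kappa$ of degree $d$ has a finite crossing number $c$, and $$c\le \tfrac12(d-2)(d-3).$$ -/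

import Mathlib

open Polynomial

noncomputable section

namespace PolynomialKnots

/-- Euclidean `n`-space. -/
abbrev E (n : ℕ) : Type := EuclideanSpace ℝ (Fin n)

/-- The circle `S¹`, as the one point compactification of `ℝ`. -/
abbrev S1 : Type := OnePoint ℝ

/-- The sphere `S³`, as the one point compactification of `ℝ³`. -/
abbrev S3 : Type := OnePoint (E 3)

/-- A self-homeomorphism of (a space homeomorphic to) the `n`-sphere, `n ≥ 1`, preserves
orientation if it has degree one, i.e. acts as the identity on the `n`-th singular homology
group with integer coefficients. -/
def OrientationPreserving (n : ℕ) {X : Type} [TopologicalSpace X] (g : X ≃ₜ X) : Prop :=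
  ((AlgebraicTopology.singularHomologyFunctor AddCommGrpCat.{0} n).obj (AddCommGrpCat.of ℤ)).map
      (TopCat.ofHom (g : C(X, X))) =
    CategoryTheory.CategoryStruct.id _

/-- Topological equivalence ("same knot type") of knots `S¹ → S³`. -/
def KnotEquivalent (α₀ α₁ : S1 → S3) : Prop :=
  ∃ (f : S1 ≃ₜ S1) (g : S3 ≃ₜ S3),
    OrientationPreserving 1 f ∧ OrientationPreserving 3 g ∧ α₀ = g ∘ α₁ ∘ f

/-- The closed plane curve `γ` crosses itself transversally at the parameter values `p` and `q`:
for suitable local parametrizations `φ`, `ψ` of the circle near `p` and `q`, the two branches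
have linearly independent tangent vectors. -/
def TransverseAt (γ : S1 → E 2) (p q : S1) : Prop :=
  ∃ φ ψ : ℝ → S1, Topology.IsOpenEmbedding φ ∧ Topology.IsOpenEmbedding ψ ∧
    φ 0 = p ∧ ψ 0 = q ∧
    ∃ u v : E 2, HasDerivAt (γ ∘ φ) u 0 ∧ HasDerivAt (γ ∘ ψ) v 0 ∧
      LinearIndependent ℝ ![u, v]

/-- The multiple points of a closed plane curve. -/
def multiplePoints (γ : S1 → E 2) : Set (E 2) :=
  {x | ∃ p q : S1, p ≠ q ∧ γ p = x ∧ γ q = x}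

/-- `P ∘ K` is a regular planar projection of the knot `K` in `ℝ³`: `P` is a linear projection
onto a plane, and `P ∘ K` has only finitely many multiple points, each of which is a transverse
double point (a crossing). -/
structure RegularProjection (K : S1 → E 3) (P : E 3 →ₗ[ℝ] E 2) : Prop where
  surjective : Function.Surjective P
  finite : (multiplePoints (P ∘ K)).Finite
  double : ∀ x, {p : S1 | (P ∘ K) p = x}.encard ≤ 2
  transverse : ∀ p q : S1, p ≠ q → (P ∘ K) p = (P ∘ K) q → TransverseAt (P ∘ K) p q

/-- The crossing number of a knot `α : S¹ → S³`: the least number of crossings in a regular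
planar projection of a knot `K` in `ℝ³ ⊆ S³` of the same knot type as `α`.
It is `⊤` if there is no such projection. -/
def crossingNumber (α : S1 → S3) : ℕ∞ :=
  sInf {m | ∃ (K : S1 → E 3) (P : E 3 →ₗ[ℝ] E 2),
    Topology.IsEmbedding K ∧ KnotEquivalent (fun p ↦ ((K p : E 3) : S3)) α ∧
    RegularProjection K P ∧ m = (multiplePoints (P ∘ K)).encard}

/-- The polynomial map `ℝ → ℝⁿ` with the given components. -/
def curve {n : ℕ} (κ : Fin n → ℝ[X]) (t : ℝ) : E n :=
  WithLp.toLp 2 fun i ↦ (κ i).eval t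

/-- The polynomials `κ i` are the components of a polynomial knot, i.e. of a smooth embedding
`ℝ → ℝⁿ`: an injective immersion. (It is nonconstant, hence proper, hence automatically a
homeomorphism onto its image.) -/
structure IsPolynomialKnot {n : ℕ} (κ : Fin n → ℝ[X]) : Prop where
  injective : Function.Injective (curve κ)
  immersion : ∀ t, deriv (curve κ) t ≠ 0

/-- The degree of a polynomial map: the maximal degree of its components. -/
def degree {n : ℕ} (κ : Fin n → ℝ[X]) : ℕ :=
  Finset.univ.sup fun i ↦ (κ i).natDegree

/-- The one point compactification `S¹ → S³` of a polynomial map `ℝ → ℝ³`. -/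
def completion (κ : Fin 3 → ℝ[X]) : S1 → S3 :=
  OnePoint.map (curve κ)

end PolynomialKnots

end

noncomputable section

namespace PolynomialKnots

/-!
Subtracting multiples of `z` from `x` and `y` and rotating the plane leaves a presentation of the
knot in which `x` and `y` have degrees at most `d - 2` and `d - 1`. The double points of the plane
curve `(x, y)` are common zeros of the divided differences `(x(s) - x(t)) / (s - t)` and
`(y(s) - y(t)) / (s - t)`, of degrees at most `d - 3` and `d - 2`, so their parameters are roots of
a resultant of degree at most `(d - 3)(d - 2)`, as in Bézout's theorem. Each crossing uses up two
parameters, hence the factor `1 / 2`.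

The resultant is nonzero and all multiple points are transverse double points after adding
`a t + b t²` to the plane curve, for suitable arbitrarily small `a, b : ℂ` (Sard's lemma). This does
not change the knot type: with `z` untouched, the two unbounded ends, on which `z` is monotone, can
be straightened into vertical lines, and on the compact part that is left the change is a small
Lipschitz perturbation. Finally, the compactified knot passes through `∞`, and is moved into `ℝ³` by
an inversion of `S³` which induces an inversion of the projection plane and so keeps the crossings.
-/

open Filter Topology MeasureTheory

/-! ### Orientation and ambient equivalence -/

section Orientation

variable {n : ℕ} {X Y : Type} [TopologicalSpace X] [TopologicalSpace Y]

theorem OrientationPreserving.refl : OrientationPreserving n (Homeomorph.refl X) :=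
  CategoryTheory.Functor.map_id _ _

theorem OrientationPreserving.trans {g h : X ≃ₜ X} (hg : OrientationPreserving n g)
    (hh : OrientationPreserving n h) : OrientationPreserving n (g.trans h) := by
  unfold OrientationPreserving at *
  have hcomp : TopCat.ofHom ((g.trans h : X ≃ₜ X) : C(X, X)) =
      CategoryTheory.CategoryStruct.comp (TopCat.ofHom (g : C(X, X)))
        (TopCat.ofHom (h : C(X, X))) := rfl
  rw [hcomp, CategoryTheory.Functor.map_comp, hg, hh, CategoryTheory.Category.comp_id]

theorem OrientationPreserving.conj {g : Y ≃ₜ Y} (hg : OrientationPreserving n g) (c : X ≃ₜ Y) :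
    OrientationPreserving n ((c.trans g).trans c.symm) := by
  unfold OrientationPreserving at *
  have hcomp : TopCat.ofHom (((c.trans g).trans c.symm : X ≃ₜ X) : C(X, X)) =
      CategoryTheory.CategoryStruct.comp (TopCat.ofHom (c : C(X, Y)))
        (CategoryTheory.CategoryStruct.comp (TopCat.ofHom (g : C(Y, Y)))
          (TopCat.ofHom (c.symm : C(Y, X)))) := rfl
  have hid : CategoryTheory.CategoryStruct.comp (TopCat.ofHom (c : C(X, Y)))
      (TopCat.ofHom (c.symm : C(Y, X))) = CategoryTheory.CategoryStruct.id (TopCat.of X) := by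
    rw [← TopCat.ofHom_comp, ← TopCat.ofHom_id, Homeomorph.symm_comp_toContinuousMap]
  rw [hcomp, CategoryTheory.Functor.map_comp, CategoryTheory.Functor.map_comp, hg,
    CategoryTheory.Category.id_comp, ← CategoryTheory.Functor.map_comp, hid,
    CategoryTheory.Functor.map_id]

theorem OrientationPreserving.symm {g : X ≃ₜ X} (hg : OrientationPreserving n g) :
    OrientationPreserving n g.symm := by
  unfold OrientationPreserving at *
  have hid : CategoryTheory.CategoryStruct.comp (TopCat.ofHom (g : C(X, X)))
      (TopCat.ofHom (g.symm : C(X, X))) = CategoryTheory.CategoryStruct.id (TopCat.of X) := by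
    rw [← TopCat.ofHom_comp, ← TopCat.ofHom_id, Homeomorph.symm_comp_toContinuousMap]
  rw [← CategoryTheory.Category.id_comp (CategoryTheory.Functor.map _ _), ← hg,
    ← CategoryTheory.Functor.map_comp, hid, hg, CategoryTheory.Functor.map_id]

theorem OrientationPreserving.of_homotopy {g h : X ≃ₜ X} (hg : OrientationPreserving n g)
    {H : unitInterval × X → X} (hH : Continuous H) (h0 : ∀ x, H (0, x) = g x)
    (h1 : ∀ x, H (1, x) = h x) : OrientationPreserving n h := by
  unfold OrientationPreserving at *
  let F : TopCat.Homotopy (TopCat.ofHom (g : C(X, X))) (TopCat.ofHom (h : C(X, X))) :=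
    { toContinuousMap := ⟨H, hH⟩
      map_zero_left := h0
      map_one_left := h1 }
  exact (F.congr_homologyMap_singularChainComplexFunctor _ n).symm.trans hg

end Orientation

theorem continuous_onePointMap_of_isProperMap {I X Y : Type*} [TopologicalSpace I]
    [TopologicalSpace X] [T2Space X] [TopologicalSpace Y] {H : I × X → Y} (hH : IsProperMap H) :
    Continuous fun p : I × OnePoint X ↦ OnePoint.map (fun x ↦ H (p.1, x)) p.2 := by
  rw [continuous_iff_continuousAt]
  rintro ⟨s, x⟩
  induction x using OnePoint.rec with
  | infty =>
    rw [ContinuousAt, OnePoint.map_infty, OnePoint.hasBasis_nhds_infty.tendsto_right_iff]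
    rintro K ⟨-, hK⟩
    have hC : IsCompact (Prod.snd '' (H ⁻¹' K)) := (hH.isCompact_preimage hK).image continuous_snd
    have hU : IsOpen ((↑) '' (Prod.snd '' (H ⁻¹' K)) : Set (OnePoint X))ᶜ :=
      OnePoint.isOpen_compl_image_coe.2 ⟨hC.isClosed, hC⟩
    filter_upwards [(hU.preimage continuous_snd).mem_nhds (by simp)]
    rintro ⟨s', x'⟩ hx'
    induction x' using OnePoint.rec with
    | infty => simp
    | coe x' => exact Or.inl ⟨_, fun hmem ↦ hx' ⟨x', ⟨_, hmem, rfl⟩, rfl⟩, rfl⟩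
  | coe x =>
    have hι : IsOpenEmbedding (Prod.map (id : I → I) ((↑) : X → OnePoint X)) :=
      IsOpenEmbedding.id.prodMap OnePoint.isOpenEmbedding_coe
    change ContinuousAt _ (Prod.map (id : I → I) ((↑) : X → OnePoint X) (s, x))
    rw [← hι.continuousAt_iff]
    exact (OnePoint.continuous_coe.comp hH.continuous).continuousAt

theorem orientationPreserving_onePointCongr_of_isProperMap {n : ℕ} {X : Type}
    [TopologicalSpace X] [T2Space X] {h : X ≃ₜ X} {H : unitInterval × X → X}
    (hH : IsProperMap H) (h0 : ∀ x, H (0, x) = x) (h1 : ∀ x, H (1, x) = h x) :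
    OrientationPreserving n h.onePointCongr := by
  refine OrientationPreserving.refl.of_homotopy (continuous_onePointMap_of_isProperMap hH)
    (fun x ↦ ?_) fun x ↦ ?_ <;> induction x using OnePoint.rec <;> simp [h0, h1]

/-- Two families of points of `X` correspond to each other under a self-homeomorphism of `X` whose
extension to the one-point compactification, assumed to be an `n`-sphere, preserves orientation. -/
def AmbientEquivalent (n : ℕ) {ι : Type*} {X : Type} [TopologicalSpace X] (k k' : ι → X) : Prop :=
  ∃ h : X ≃ₜ X, OrientationPreserving n h.onePointCongr ∧ h ∘ k = k'

namespace AmbientEquivalent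

variable {n : ℕ} {ι : Type*}

section General

variable {X : Type} [TopologicalSpace X] {k k' k'' : ι → X}

theorem refl (k : ι → X) : AmbientEquivalent n k k := by
  refine ⟨Homeomorph.refl X, ?_, rfl⟩
  convert OrientationPreserving.refl (n := n) (X := OnePoint X) using 1
  ext1 x
  induction x using OnePoint.rec <;> rfl

theorem symm : AmbientEquivalent n k k' → AmbientEquivalent n k' k := by
  rintro ⟨h, hh, rfl⟩
  exact ⟨h.symm, hh.symm, by ext; simp⟩

theorem trans : AmbientEquivalent n k k' → AmbientEquivalent n k' k'' →
    AmbientEquivalent n k k'' := by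
  rintro ⟨g, hg, rfl⟩ ⟨h, hh, rfl⟩
  refine ⟨g.trans h, ?_, rfl⟩
  convert hg.trans hh using 1
  ext x
  induction x using OnePoint.rec <;> rfl

theorem injective (hk : AmbientEquivalent n k k') (hinj : Function.Injective k) :
    Function.Injective k' := by
  obtain ⟨h, -, rfl⟩ := hk
  exact h.injective.comp hinj

theorem of_isotopy [T2Space X] {H G : unitInterval × X → X} (hH : Continuous H)
    (hG : Continuous G) (hGH : ∀ s x, G (s, H (s, x)) = x) (hHG : ∀ s x, H (s, G (s, x)) = x)
    (h0 : ∀ x, H (0, x) = x) : AmbientEquivalent n k fun i ↦ H (1, k i) := by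
  let Φ : unitInterval × X ≃ₜ unitInterval × X :=
    { toFun := fun p ↦ (p.1, H p)
      invFun := fun p ↦ (p.1, G p)
      left_inv := fun p ↦ by simp [hGH]
      right_inv := fun p ↦ by simp [hHG]
      continuous_toFun := by fun_prop
      continuous_invFun := by fun_prop }
  let h : X ≃ₜ X :=
    { toFun := fun x ↦ H (1, x)
      invFun := fun x ↦ G (1, x)
      left_inv := hGH 1
      right_inv := hHG 1
      continuous_toFun := by fun_prop
      continuous_invFun := by fun_prop }
  have hproper : IsProperMap H := isProperMap_snd_of_compactSpace.comp Φ.isProperMap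
  exact ⟨h, orientationPreserving_onePointCongr_of_isProperMap hproper h0 fun _ ↦ rfl, rfl⟩

end General

theorem fst_add_comp_snd {W Z : Type} [AddCommGroup W] [Module ℝ W] [TopologicalSpace W]
    [IsTopologicalAddGroup W] [ContinuousSMul ℝ W] [T2Space W] [TopologicalSpace Z] [T2Space Z]
    (k : ι → W × Z) {c : Z → W} (hc : Continuous c) :
    AmbientEquivalent n k fun i ↦ ((k i).1 + c (k i).2, (k i).2) := by
  convert of_isotopy (n := n) (k := k) (H := fun p ↦ (p.2.1 + (p.1 : ℝ) • c p.2.2, p.2.2))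
    (G := fun p ↦ (p.2.1 - (p.1 : ℝ) • c p.2.2, p.2.2)) (by fun_prop) (by fun_prop)
    (by simp) (by simp) (by simp)
  simp

theorem fst_mul_comp_snd (k : ι → ℂ × ℝ) {u : ℝ → ℂ} (hu : Continuous u) (hne : ∀ z, u z ≠ 0) :
    AmbientEquivalent n k fun i ↦ ((k i).1 * u (k i).2, (k i).2) := by
  -- `u` is contracted to `1` by first rescaling its argument to `0` and then following a logarithm
  -- of `u 0`; the factor below does both at once.
  let U : unitInterval × ℂ × ℝ → ℂ := fun p ↦
    Complex.exp (p.1 * Complex.log (u 0)) * (u (p.1 * p.2.2) / u 0)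
  have hU : Continuous U := by fun_prop (disch := simp [hne])
  have hUne : ∀ p, U p ≠ 0 := fun p ↦ mul_ne_zero (Complex.exp_ne_zero _) (by simp [hne])
  convert of_isotopy (n := n) (k := k) (H := fun p ↦ (p.2.1 * U p, p.2.2))
    (G := fun p ↦ (p.2.1 / U p, p.2.2)) (by fun_prop) (by fun_prop (disch := simp [hUne]))
    (fun s v ↦ by simp [U, hne]) (fun s v ↦ by simp [U, hne]) (by simp [U, hne]) using 4
  simp [U, Complex.exp_log (hne 0), mul_div_cancel₀ _ (hne 0)]

theorem snd_affine_comp_fst {B : Type} [TopologicalSpace B] [T2Space B] (k : ι → B × ℝ)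
    {μ ν : B → ℝ} (hμ : Continuous μ) (hν : Continuous ν) (hpos : ∀ b, 0 < μ b) :
    AmbientEquivalent n k fun i ↦ ((k i).1, μ (k i).1 * (k i).2 + ν (k i).1) := by
  let M : unitInterval × B → ℝ := fun p ↦ 1 - p.1 + p.1 * μ p.2
  have hM : Continuous M := by fun_prop
  have hMne : ∀ p, M p ≠ 0 := by
    intro p
    rcases eq_or_lt_of_le p.1.2.1 with h | h
    · simp [M, ← h]
    · exact (add_pos_of_nonneg_of_pos (sub_nonneg.2 p.1.2.2) (mul_pos h (hpos p.2))).ne'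
  convert of_isotopy (n := n) (k := k)
    (H := fun p ↦ (p.2.1, M (p.1, p.2.1) * p.2.2 + (p.1 : ℝ) * ν p.2.1))
    (G := fun p ↦ (p.2.1, (p.2.2 - (p.1 : ℝ) * ν p.2.1) / M (p.1, p.2.1))) (by fun_prop)
    (by fun_prop (disch := exact fun _ ↦ hMne _)) (fun s v ↦ by simp [hMne])
    (fun s v ↦ by simp [hMne, mul_div_cancel₀]) (by simp [M]) using 4 <;> simp [M]

end AmbientEquivalent

section Lipschitz

variable {W : Type} [NormedAddCommGroup W] [NormedSpace ℝ W] [FiniteDimensional ℝ W]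
  {f : W → W} {K : NNReal}

theorem isProperMap_add_smul_of_lipschitzWith (hf : LipschitzWith K f) (hK : K < 1) :
    IsProperMap fun p : unitInterval × W ↦ p.2 + (p.1 : ℝ) • f p.2 := by
  have hcont : Continuous fun p : unitInterval × W ↦ p.2 + (p.1 : ℝ) • f p.2 := by
    have := hf.continuous
    fun_prop
  have : ProperSpace W := FiniteDimensional.proper ℝ W
  refine isProperMap_iff_isCompact_preimage.2 ⟨hcont, fun C hC ↦ ?_⟩
  obtain ⟨r, hr⟩ := hC.isBounded.subset_closedBall 0
  have hK' : (0 : ℝ) < 1 - K := sub_pos.2 hK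
  refine (isCompact_univ.prod (isCompact_closedBall 0 ((r + ‖f 0‖) / (1 - K)))).of_isClosed_subset
    (hC.isClosed.preimage hcont) ?_
  rintro ⟨s, v⟩ hv
  refine ⟨trivial, mem_closedBall_zero_iff.2 ((le_div_iff₀ hK').2 ?_)⟩
  have hsum : ‖v + (s : ℝ) • f v‖ ≤ r := mem_closedBall_zero_iff.1 (hr hv)
  have hsmul : ‖(s : ℝ) • f v‖ ≤ ‖f v‖ := by
    rw [norm_smul, Real.norm_of_nonneg s.2.1]
    exact mul_le_of_le_one_left (norm_nonneg _) s.2.2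
  have hfv : ‖f v‖ ≤ ‖f 0‖ + K * ‖v‖ := by
    simpa [add_comm] using (norm_le_norm_sub_add (f v) (f 0)).trans
      (add_le_add_left (hf.norm_sub_le v 0) _)
  linarith [norm_le_add_norm_add v ((s : ℝ) • f v)]

theorem AmbientEquivalent.add_comp_of_lipschitzWith {n : ℕ} {ι : Type*} (k : ι → W)
    (hf : LipschitzWith K f) (hK : K < 1) : AmbientEquivalent n k fun i ↦ k i + f (k i) := by
  have happrox : ApproximatesLinearOn (fun v ↦ v + f v)
      ((ContinuousLinearEquiv.refl ℝ W : W ≃L[ℝ] W) : W →L[ℝ] W) Set.univ K := fun x _ y _ ↦ by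
    simpa [add_sub_add_comm] using hf.norm_sub_le x y
  have hK' : Subsingleton W ∨
      K < ‖((ContinuousLinearEquiv.refl ℝ W).symm : W →L[ℝ] W)‖₊⁻¹ := by
    rcases subsingleton_or_nontrivial W with hW | hW
    · exact Or.inl hW
    · exact Or.inr (by simpa using hK)
  exact ⟨happrox.toHomeomorph _ hK', orientationPreserving_onePointCongr_of_isProperMap
    (isProperMap_add_smul_of_lipschitzWith hf hK) (by simp)
    fun v ↦ by rw [Set.Icc.coe_one, one_smul]; rfl, rfl⟩

variable (W) in
theorem AmbientEquivalent.exists_of_norm_sub_sub_le (n : ℕ) (ι : Type*) :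
    ∃ ε : ℝ, 0 < ε ∧ ∀ k k' : ι → W,
      (∀ i j, ‖(k' i - k i) - (k' j - k j)‖ ≤ ε * ‖k i - k j‖) → AmbientEquivalent n k k' := by
  set L := lipschitzExtensionConstant W
  have hLpos : 0 < L := lipschitzExtensionConstant_pos W
  refine ⟨((2 * L)⁻¹ : NNReal), by positivity, fun k k' hk ↦ ?_⟩
  have hfactor : Function.FactorsThrough (fun i ↦ k' i - k i) k := fun i j hij ↦ by
    simpa [hij, sub_eq_zero] using hk i j
  obtain ⟨g, hg⟩ := (Function.factorsThrough_iff _).1 hfactor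
  have hgk : ∀ i, g (k i) = k' i - k i := fun i ↦ (congrFun hg i).symm
  have hlip : LipschitzOnWith (2 * L)⁻¹ g (Set.range k) := by
    refine LipschitzOnWith.of_dist_le_mul ?_
    rintro _ ⟨i, rfl⟩ _ ⟨j, rfl⟩
    simpa only [dist_eq_norm, hgk] using hk i j
  obtain ⟨f, hf, hfg⟩ := hlip.extend_finite_dimension
  have hhalf : L * (2 * L)⁻¹ < 1 := by
    rw [mul_inv_rev, ← mul_assoc, mul_inv_cancel₀ hLpos.ne', one_mul]
    exact inv_lt_one_of_one_lt₀ one_lt_two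
  convert add_comp_of_lipschitzWith k hf hhalf using 2 with i
  rw [← hfg ⟨i, rfl⟩, hgk, add_sub_cancel]

end Lipschitz

/-! ### Inversion of the three-sphere -/

section Inversion

variable {W B : Type} [NormedAddCommGroup W] [NormedAddCommGroup B]

variable (W) in
/-- The unit sphere of `W × ℝ` for the norm `√(‖w‖ ^ 2 + k ^ 2)`, as the target of the
stereographic projection from `W`. The norm of `W` need not be Euclidean. -/
abbrev StereoSphere : Type := Metric.sphere (0 : WithLp 2 (W × ℝ)) 1

theorem mem_stereoSphere_iff {p : WithLp 2 (W × ℝ)} :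
    p ∈ Metric.sphere (0 : WithLp 2 (W × ℝ)) 1 ↔ ‖p.fst‖ ^ 2 + p.snd ^ 2 = 1 := by
  rw [mem_sphere_zero_iff_norm, ← sq_eq_sq₀ (norm_nonneg _) zero_le_one,
    WithLp.prod_norm_sq_eq_of_L2, Real.norm_eq_abs, sq_abs, one_pow]

namespace StereoSphere

theorem ext {p q : StereoSphere W} (hfst : p.1.fst = q.1.fst) (hsnd : p.1.snd = q.1.snd) :
    p = q :=
  Subtype.ext (WithLp.ofLp_injective 2 (Prod.ext hfst hsnd))

variable (W) in
/-- The pole of the stereographic projection. -/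
def pole : StereoSphere W := ⟨WithLp.toLp 2 (0, 1), by simp⟩

theorem snd_ne_one {p : StereoSphere W} (hp : p ≠ pole W) : p.1.snd ≠ 1 := by
  intro h
  have hfst : ‖p.1.fst‖ ^ 2 = 0 := by simpa [h] using mem_stereoSphere_iff.1 p.2
  exact hp (ext (by simpa [pole] using hfst) h)

variable [NormedSpace ℝ W]

/-- The inverse of the stereographic projection from the pole. -/
def ofPoint (v : W) : StereoSphere W :=
  ⟨WithLp.toLp 2 ((2 / (‖v‖ ^ 2 + 1)) • v, (‖v‖ ^ 2 - 1) / (‖v‖ ^ 2 + 1)), by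
    simp only [mem_stereoSphere_iff, WithLp.toLp_fst, WithLp.toLp_snd, norm_smul, mul_pow,
      Real.norm_eq_abs, sq_abs]
    field_simp
    ring⟩

theorem ofPoint_ne_pole (v : W) : ofPoint v ≠ pole W := by
  intro h
  have hsnd : (‖v‖ ^ 2 - 1) / (‖v‖ ^ 2 + 1) = 1 := congrArg (fun p ↦ p.1.snd) h
  rw [div_eq_one_iff_eq (by positivity)] at hsnd
  linarith

/-- Stereographic projection from the pole. -/
def stereographic : W ≃ₜ ({pole W}ᶜ : Set (StereoSphere W)) where
  toFun v := ⟨ofPoint v, ofPoint_ne_pole v⟩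
  invFun p := (1 - p.1.1.snd)⁻¹ • p.1.1.fst
  left_inv v := by
    have h : 1 - (‖v‖ ^ 2 - 1) / (‖v‖ ^ 2 + 1) = 2 / (‖v‖ ^ 2 + 1) := by field_simp; ring
    have h0 : 2 / (‖v‖ ^ 2 + 1) ≠ 0 := by positivity
    simp only [ofPoint, h, WithLp.toLp_fst, WithLp.toLp_snd, smul_smul, inv_mul_cancel₀ h0,
      one_smul]
  right_inv p := by
    have h1 : 1 - p.1.1.snd ≠ 0 := sub_ne_zero.2 (snd_ne_one p.2).symm
    have hp := mem_stereoSphere_iff.1 p.1.2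
    have hnorm : ‖(1 - p.1.1.snd)⁻¹ • p.1.1.fst‖ ^ 2 = (1 + p.1.1.snd) / (1 - p.1.1.snd) := by
      rw [norm_smul, mul_pow, Real.norm_eq_abs, sq_abs, eq_div_iff h1]
      field_simp
      linear_combination hp
    have h2 : (1 + p.1.1.snd) / (1 - p.1.1.snd) + 1 = 2 / (1 - p.1.1.snd) := by field_simp; ring
    refine Subtype.ext (ext ?_ ?_)
    · simp only [ofPoint, hnorm, h2, smul_smul, WithLp.toLp_fst]
      rw [div_div_cancel₀ two_ne_zero, mul_inv_cancel₀ h1, one_smul]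
    · simp only [ofPoint, hnorm, h2, WithLp.toLp_snd]
      field_simp
      ring
  continuous_toFun := by
    unfold ofPoint
    fun_prop (disch := intros; positivity)
  continuous_invFun := by
    refine Continuous.smul (Continuous.inv₀ (by fun_prop) fun p ↦ ?_) (by fun_prop)
    exact sub_ne_zero.2 (snd_ne_one p.2).symm

section HalfTurn

/-- The rotation by the angle `θ` in the plane spanned by the two real coordinate axes. -/
def rotate (θ : ℝ) (p : WithLp 2 ((B × ℝ) × ℝ)) : WithLp 2 ((B × ℝ) × ℝ) :=
  WithLp.toLp 2 ((p.fst.1, Real.cos θ * p.fst.2 - Real.sin θ * p.snd),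
    Real.sin θ * p.fst.2 + Real.cos θ * p.snd)

theorem rotate_ne_zero (θ : ℝ) {p : WithLp 2 ((B × ℝ) × ℝ)} (hp : p ≠ 0) : rotate θ p ≠ 0 := by
  contrapose! hp
  have h1 : p.fst.1 = 0 := congrArg (fun q ↦ q.fst.1) hp
  have h2 : Real.cos θ * p.fst.2 - Real.sin θ * p.snd = 0 := congrArg (fun q ↦ q.fst.2) hp
  have h3 : Real.sin θ * p.fst.2 + Real.cos θ * p.snd = 0 := congrArg (fun q ↦ q.snd) hp
  refine WithLp.ofLp_injective 2 (Prod.ext (Prod.ext h1 ?_) ?_)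
  · change p.fst.2 = 0
    linear_combination Real.cos θ * h2 + Real.sin θ * h3 - p.fst.2 * Real.sin_sq_add_cos_sq θ
  · change p.snd = 0
    linear_combination Real.cos θ * h3 - Real.sin θ * h2 - p.snd * Real.sin_sq_add_cos_sq θ

variable [NormedSpace ℝ B]

variable (B) in
/-- The half turn of the sphere in the plane spanned by the two real coordinate axes. -/
def halfTurn : StereoSphere (B × ℝ) ≃ₜ StereoSphere (B × ℝ) :=
  have hmem (p : StereoSphere (B × ℝ)) : WithLp.toLp 2 ((p.1.fst.1, -p.1.fst.2), -p.1.snd) ∈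
      Metric.sphere (0 : WithLp 2 ((B × ℝ) × ℝ)) 1 := by
    rw [mem_stereoSphere_iff]
    simpa [Prod.norm_def] using mem_stereoSphere_iff.1 p.2
  { toFun := fun p ↦ ⟨_, hmem p⟩
    invFun := fun p ↦ ⟨_, hmem p⟩
    left_inv := fun p ↦ ext (by simp) (by simp)
    right_inv := fun p ↦ ext (by simp) (by simp)
    continuous_toFun := by fun_prop
    continuous_invFun := by fun_prop }

theorem orientationPreserving_halfTurn (n : ℕ) : OrientationPreserving n (halfTurn B) := by
  -- The norm of `B × ℝ` need not be invariant under the rotations, so these are normalized.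
  let R : unitInterval × StereoSphere (B × ℝ) → WithLp 2 ((B × ℝ) × ℝ) :=
    fun q ↦ rotate (q.1 * Real.pi) q.2.1
  have hR : Continuous R := by unfold R rotate; fun_prop
  have hne : ∀ q, R q ≠ 0 := fun q ↦ rotate_ne_zero _ (ne_zero_of_mem_unit_sphere q.2)
  have h0 : ∀ p, R (0, p) = p := fun p ↦
    WithLp.ofLp_injective 2 (Prod.ext (by simp [R, rotate]) (by simp [R, rotate]))
  have h1 : ∀ p, R (1, p) = halfTurn B p := fun p ↦
    WithLp.ofLp_injective 2 (by simp [R, rotate, halfTurn])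
  refine OrientationPreserving.refl.of_homotopy
    (H := fun q ↦ ⟨NormedSpace.normalize (R q), by simp [hne]⟩) ?_ (fun p ↦ ?_) fun p ↦ ?_
  · exact ((hR.norm.inv₀ fun q ↦ norm_ne_zero_iff.2 (hne q)).smul hR).subtype_mk _
  · exact Subtype.ext ((congrArg _ (h0 p)).trans
      (NormedSpace.normalize_eq_self_of_norm_eq_one (norm_eq_of_mem_sphere p)))
  · exact Subtype.ext ((congrArg _ (h1 p)).trans
      (NormedSpace.normalize_eq_self_of_norm_eq_one (norm_eq_of_mem_sphere _)))

end HalfTurn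

variable [FiniteDimensional ℝ W]

instance : CompactSpace (StereoSphere W) :=
  have : ProperSpace (WithLp 2 (W × ℝ)) := FiniteDimensional.proper ℝ _
  inferInstance

variable (W) in
/-- The one-point compactification of `W` is the sphere, by stereographic projection. -/
def onePointHomeomorph : OnePoint W ≃ₜ StereoSphere W :=
  OnePoint.equivOfIsEmbeddingOfRangeEq (pole W) ofPoint
    (IsEmbedding.subtypeVal.comp stereographic.isEmbedding)
    ((stereographic.surjective.range_comp Subtype.val).trans Subtype.range_val)

end StereoSphere

variable [NormedSpace ℝ B] [FiniteDimensional ℝ B]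

variable (B) in
/-- The inversion `(w, h) ↦ (w, -h) / ‖(w, h)‖ ^ 2` of the sphere, composed of the inversion in the
unit ball and a reflection. -/
def inversion : OnePoint (B × ℝ) ≃ₜ OnePoint (B × ℝ) :=
  ((StereoSphere.onePointHomeomorph _).trans (StereoSphere.halfTurn B)).trans
    (StereoSphere.onePointHomeomorph _).symm

theorem orientationPreserving_inversion (n : ℕ) : OrientationPreserving n (inversion B) :=
  (StereoSphere.orientationPreserving_halfTurn n).conj _

theorem inversion_infty : inversion B OnePoint.infty = ((0 : B × ℝ) : OnePoint (B × ℝ)) := by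
  refine (StereoSphere.onePointHomeomorph (B × ℝ)).symm_apply_eq.2 (StereoSphere.ext ?_ ?_)
  · change ((0 : B), -(0 : ℝ)) = (2 / (‖(0 : B × ℝ)‖ ^ 2 + 1)) • (0 : B × ℝ)
    simp
  · change -(1 : ℝ) = (‖(0 : B × ℝ)‖ ^ 2 - 1) / (‖(0 : B × ℝ)‖ ^ 2 + 1)
    simp

theorem inversion_coe {v : B × ℝ} (hv : v ≠ 0) :
    inversion B v = (((‖v‖ ^ 2)⁻¹ • (v.1, -v.2) : B × ℝ) : OnePoint (B × ℝ)) := by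
  have : 0 < ‖v‖ := norm_pos_iff.2 hv
  have hnorm : ‖(‖v‖ ^ 2)⁻¹ • ((v.1, -v.2) : B × ℝ)‖ = ‖v‖⁻¹ := by
    have hneg : ‖((v.1, -v.2) : B × ℝ)‖ = ‖v‖ := by simp [Prod.norm_def]
    rw [norm_smul, hneg, norm_inv, norm_pow, norm_norm]
    field_simp
  refine (StereoSphere.onePointHomeomorph (B × ℝ)).symm_apply_eq.2 (StereoSphere.ext ?_ ?_)
  · change ((2 / (‖v‖ ^ 2 + 1)) • v.1, -((2 / (‖v‖ ^ 2 + 1)) • v.2)) =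
      (2 / (‖(‖v‖ ^ 2)⁻¹ • ((v.1, -v.2) : B × ℝ)‖ ^ 2 + 1)) • (‖v‖ ^ 2)⁻¹ • (v.1, -v.2)
    rw [hnorm, smul_smul, ← smul_neg, ← Prod.smul_mk]
    congr 1
    field_simp
    ring
  · change -((‖v‖ ^ 2 - 1) / (‖v‖ ^ 2 + 1)) = (‖(‖v‖ ^ 2)⁻¹ • ((v.1, -v.2) : B × ℝ)‖ ^ 2 - 1) /
      (‖(‖v‖ ^ 2)⁻¹ • ((v.1, -v.2) : B × ℝ)‖ ^ 2 + 1)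
    rw [hnorm]
    field_simp
    ring

end Inversion

/-! ### Closing a curve by inversion -/

section PlaneCurve

/-- A regular plane curve `P`: it is `C¹`, and its multiple points are transverse double points,
with parameter values in `S`. -/
structure IsRegularPlaneCurve (P : ℝ → ℂ) (S : Finset ℝ) : Prop where
  contDiff : ContDiff ℝ 1 P
  transverse : ∀ s t, s ≠ t → P s = P t → LinearIndependent ℝ ![deriv P s, deriv P t]
  double : ∀ s t u, P s = P t → P s = P u → s = t ∨ s = u ∨ t = u
  mem : ∀ s t, s ≠ t → P s = P t → s ∈ S

theorem IsRegularPlaneCurve.sub_const {P : ℝ → ℂ} {S : Finset ℝ} (hP : IsRegularPlaneCurve P S)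
    (q : ℂ) : IsRegularPlaneCurve (fun t ↦ P t - q) S where
  contDiff := hP.contDiff.sub contDiff_const
  transverse s t hst h := by simpa [deriv_sub_const] using hP.transverse s t hst (sub_left_inj.1 h)
  double s t u hst hsu := hP.double s t u (sub_left_inj.1 hst) (sub_left_inj.1 hsu)
  mem s t hst h := hP.mem s t hst (sub_left_inj.1 h)

/-- The closure of a plane curve avoiding `0` after the inversion in the unit circle. -/
def closedPlaneCurve (P : ℝ → ℂ) (p : S1) : ℂ :=
  p.elim 0 fun t ↦ EuclideanGeometry.inversion 0 1 (P t)

/-- The identification of the complex plane with the Euclidean plane. -/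
def planeCoords : ℂ ≃ₗᵢ[ℝ] E 2 := Complex.orthonormalBasisOneI.repr

variable {P : ℝ → ℂ} {S : Finset ℝ} {p q : S1}

theorem eq_or_exists_of_closedPlaneCurve_eq (h0 : ∀ t, P t ≠ 0)
    (h : closedPlaneCurve P p = closedPlaneCurve P q) :
    p = q ∨ ∃ s t : ℝ, p = s ∧ q = t ∧ P s = P t := by
  have hinj := EuclideanGeometry.inversion_injective (0 : ℂ) (one_ne_zero (α := ℝ))
  have hne (t : ℝ) : EuclideanGeometry.inversion 0 1 (P t) ≠ 0 := fun ht ↦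
    h0 t (hinj (ht.trans (EuclideanGeometry.inversion_self _ _).symm))
  induction p using OnePoint.rec with
  | infty =>
    induction q using OnePoint.rec with
    | infty => exact Or.inl rfl
    | coe t => exact absurd h.symm (hne t)
  | coe s =>
    induction q using OnePoint.rec with
    | infty => exact absurd h (hne s)
    | coe t => exact Or.inr ⟨s, t, rfl, rfl, hinj h⟩

namespace IsRegularPlaneCurve

theorem transverseAt_closedPlaneCurve (hP : IsRegularPlaneCurve P S) (h0 : ∀ t, P t ≠ 0)
    (hpq : p ≠ q) (h : closedPlaneCurve P p = closedPlaneCurve P q) :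
    TransverseAt (planeCoords ∘ closedPlaneCurve P) p q := by
  obtain ⟨s, t, rfl, rfl, hst⟩ := (eq_or_exists_of_closedPlaneCurve_eq h0 h).resolve_left hpq
  have hopen (r : ℝ) : IsOpenEmbedding fun a : ℝ ↦ ((r + a : ℝ) : S1) :=
    OnePoint.isOpenEmbedding_coe.comp (Homeomorph.addLeft r).isOpenEmbedding
  let A (w : ℂ) : ℂ →L[ℝ] ℂ := (1 / dist w 0) ^ 2 • ((ℝ ∙ (w - 0))ᗮ.reflection : ℂ →L[ℝ] ℂ)
  have hA : Function.Injective (A (P s)) :=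
    (smul_right_injective ℂ (pow_ne_zero 2 (one_div_ne_zero (dist_ne_zero.2 (h0 s))))).comp
      (ℝ ∙ (P s - 0))ᗮ.reflection.injective
  have hder (r : ℝ) : HasDerivAt
      ((planeCoords ∘ closedPlaneCurve P) ∘ fun a : ℝ ↦ ((r + a : ℝ) : S1))
      (planeCoords (A (P r) (deriv P r))) 0 := by
    have hr : HasDerivAt P (deriv P r) (r + 0) := by
      rw [add_zero]
      exact (hP.contDiff.differentiable one_ne_zero r).hasDerivAt
    have hinv := EuclideanGeometry.hasFDerivAt_inversion (R := 1) (h0 r)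
    rw [← add_zero r] at hinv
    have := hinv.comp_hasDerivAt 0 (hr.comp_const_add r 0)
    rw [add_zero] at this
    exact planeCoords.toContinuousLinearEquiv.hasFDerivAt.comp_hasDerivAt 0 this
  refine ⟨_, _, hopen s, hopen t, by simp, by simp, _, _, hder s, hder t, ?_⟩
  have hne : s ≠ t := fun h ↦ hpq (congrArg _ h)
  have hmap := (hP.transverse s t hne hst).map'
    (planeCoords.toLinearMap ∘ₗ (A (P s)).toLinearMap)
    (LinearMap.ker_eq_bot.2 (planeCoords.injective.comp hA))
  rw [← hst]
  convert! hmap using 1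
  ext i
  fin_cases i <;> rfl

theorem encard_fiber_closedPlaneCurve_le (hP : IsRegularPlaneCurve P S) (h0 : ∀ t, P t ≠ 0)
    (w : ℂ) : {p : S1 | closedPlaneCurve P p = w}.encard ≤ 2 := by
  by_contra! hlt
  obtain ⟨T, hTsub, hT⟩ := Set.exists_subset_encard_eq (Order.add_one_le_of_lt hlt)
  obtain ⟨a, b, c, hab, hac, hbc, rfl⟩ := Set.encard_eq_three.1 (hT.trans two_add_one_eq_three)
  have ha : closedPlaneCurve P a = w := hTsub (by simp)
  have hb : closedPlaneCurve P b = w := hTsub (by simp)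
  have hc : closedPlaneCurve P c = w := hTsub (by simp)
  obtain ⟨s, t, rfl, rfl, hst⟩ :=
    (eq_or_exists_of_closedPlaneCurve_eq h0 (ha.trans hb.symm)).resolve_left hab
  obtain ⟨s', u, hs', rfl, hsu⟩ :=
    (eq_or_exists_of_closedPlaneCurve_eq h0 (ha.trans hc.symm)).resolve_left hac
  obtain rfl : s = s' := OnePoint.coe_injective hs'
  rcases hP.double s t u hst hsu with rfl | rfl | rfl
  exacts [hab rfl, hac rfl, hbc rfl]

theorem exists_pair_of_mem_multiplePoints (hP : IsRegularPlaneCurve P S) (h0 : ∀ t, P t ≠ 0)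
    {w : E 2} (hw : w ∈ multiplePoints (planeCoords ∘ closedPlaneCurve P)) :
    ∃ s ∈ S, ∃ t ∈ S, s ≠ t ∧ planeCoords (closedPlaneCurve P s) = w ∧
      planeCoords (closedPlaneCurve P t) = w := by
  obtain ⟨p, q, hpq, hp, hq⟩ := hw
  obtain ⟨s, t, rfl, rfl, hst⟩ := (eq_or_exists_of_closedPlaneCurve_eq h0
    (planeCoords.injective (hp.trans hq.symm))).resolve_left hpq
  have hne : s ≠ t := fun h ↦ hpq (congrArg _ h)
  exact ⟨s, hP.mem s t hne hst, t, hP.mem t s hne.symm hst.symm, hne, hp, hq⟩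

theorem finite_multiplePoints (hP : IsRegularPlaneCurve P S) (h0 : ∀ t, P t ≠ 0) :
    (multiplePoints (planeCoords ∘ closedPlaneCurve P)).Finite := by
  refine (S.finite_toSet.image fun t : ℝ ↦ planeCoords (closedPlaneCurve P t)).subset fun w hw ↦ ?_
  obtain ⟨s, hs, -, -, -, hsw, -⟩ := hP.exists_pair_of_mem_multiplePoints h0 hw
  exact ⟨s, hs, hsw⟩

theorem two_mul_encard_multiplePoints_le (hP : IsRegularPlaneCurve P S) (h0 : ∀ t, P t ≠ 0) :
    2 * (multiplePoints (planeCoords ∘ closedPlaneCurve P)).encard ≤ S.card := by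
  classical
  set M := multiplePoints (planeCoords ∘ closedPlaneCurve P)
  have hM : M.Finite := hP.finite_multiplePoints h0
  let γ (t : ℝ) : E 2 := planeCoords (closedPlaneCurve P t)
  have hcard : 2 * hM.toFinset.card ≤ (S.filter (γ · ∈ M)).card := by
    refine Finset.mul_card_image_le_card_of_maps_to (f := γ) ?_ 2 fun w hw ↦ ?_
    · exact fun t ht ↦ hM.mem_toFinset.2 (Finset.mem_filter.1 ht).2
    rw [hM.mem_toFinset] at hw
    obtain ⟨s, hs, t, ht, hne, hsw, htw⟩ := hP.exists_pair_of_mem_multiplePoints h0 hw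
    refine (Finset.card_pair hne).ge.trans (Finset.card_le_card ?_)
    simp [Finset.insert_subset_iff, γ, hs, ht, hsw, htw, hw]
  rw [hM.encard_eq_coe_toFinset_card]
  exact_mod_cast hcard.trans (Finset.card_filter_le _ _)

end IsRegularPlaneCurve

end PlaneCurve

section Closing

/-- The identification of Euclidean three-space with `ℂ × ℝ`. -/
def coords : E 3 ≃L[ℝ] ℂ × ℝ :=
  LinearEquiv.toContinuousLinearEquiv
    { toFun := fun v ↦ (⟨v 0, v 1⟩, v 2)
      invFun := fun w ↦ WithLp.toLp 2 ![w.1.re, w.1.im, w.2]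
      left_inv := fun v ↦ by ext i; fin_cases i <;> rfl
      right_inv := fun _ ↦ rfl
      map_add' := fun _ _ ↦ rfl
      map_smul' := fun c v ↦ Prod.ext (Complex.ext (by simp) (by simp)) rfl }

/-- The vertical projection of three-space. -/
def verticalProjection : E 3 →ₗ[ℝ] E 2 :=
  planeCoords.toLinearMap ∘ₗ LinearMap.fst ℝ ℂ ℝ ∘ₗ coords.toLinearMap

/-- The compactification `S¹ → S³` of a curve in `ℂ × ℝ`. -/
def compactification (k : ℝ → ℂ × ℝ) : S1 → S3 := OnePoint.map (coords.symm ∘ k)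

theorem KnotEquivalent.trans {α β γ : S1 → S3} :
    KnotEquivalent α β → KnotEquivalent β γ → KnotEquivalent α γ := by
  rintro ⟨f, g, hf, hg, rfl⟩ ⟨f', g', hf', hg', rfl⟩
  exact ⟨f.trans f', g'.trans g, hf.trans hf', hg'.trans hg, rfl⟩

theorem KnotEquivalent.of_homeomorph_comp {α : S1 → S3} {g : S3 ≃ₜ S3}
    (hg : OrientationPreserving 3 g) : KnotEquivalent (g ∘ α) α :=
  ⟨Homeomorph.refl _, g, .refl, hg, rfl⟩

theorem AmbientEquivalent.knotEquivalent {k k' : ℝ → ℂ × ℝ} (h : AmbientEquivalent 3 k k') :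
    KnotEquivalent (compactification k') (compactification k) := by
  obtain ⟨h, hh, rfl⟩ := h
  convert KnotEquivalent.of_homeomorph_comp (hh.conj coords.toHomeomorph.onePointCongr) using 1
  ext1 p
  induction p using OnePoint.rec <;> simp [compactification]

theorem isEmbedding_compactification {k : ℝ → ℂ × ℝ} (hk : IsProperMap k)
    (hinj : Function.Injective k) : IsEmbedding (compactification k) := by
  have hcont : Continuous (compactification k) := by
    refine OnePoint.continuous_map (coords.symm.continuous.comp hk.continuous) ?_
    rw [coclosedCompact_eq_cocompact, coclosedCompact_eq_cocompact]
    exact coords.symm.toHomeomorph.isClosedEmbedding.tendsto_cocompact.comp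
      (isProperMap_iff_tendsto_cocompact.1 hk).2
  exact (hcont.isClosedEmbedding
    (Option.map_injective (coords.symm.injective.comp hinj))).isEmbedding

/-- The closed curve obtained by inversion from a curve in the cone `|h| ≤ ‖w‖` of `ℂ × ℝ`. -/
def closedCurve (k : ℝ → ℂ × ℝ) (p : S1) : E 3 :=
  coords.symm (p.elim 0 fun t ↦ (‖k t‖ ^ 2)⁻¹ • ((k t).1, -(k t).2))

variable {k k' : ℝ → ℂ × ℝ}

theorem verticalProjection_comp_closedCurve (hk : ∀ t, |(k t).2| ≤ ‖(k t).1‖) :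
    verticalProjection ∘ closedCurve k = planeCoords ∘ closedPlaneCurve fun t ↦ (k t).1 := by
  ext1 p
  induction p using OnePoint.rec with
  | infty => simp [verticalProjection, closedCurve, closedPlaneCurve]
  | coe t =>
    simp [verticalProjection, closedCurve, closedPlaneCurve, EuclideanGeometry.inversion,
      Prod.norm_def, hk]

theorem inversion_comp_compactification (hk : ∀ t, k t ≠ 0) :
    coords.toHomeomorph.onePointCongr.symm ∘ inversion ℂ ∘ coords.toHomeomorph.onePointCongr ∘
      compactification k = fun p ↦ ((closedCurve k p : E 3) : S3) := by
  ext1 p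
  induction p using OnePoint.rec with
  | infty => simp [compactification, closedCurve, inversion_infty]
  | coe t => simp [compactification, closedCurve, inversion_coe (hk t)]

theorem knotEquivalent_closedCurve (hk : ∀ t, k t ≠ 0) :
    KnotEquivalent (fun p ↦ ((closedCurve k p : E 3) : S3)) (compactification k) := by
  rw [← inversion_comp_compactification hk]
  exact KnotEquivalent.of_homeomorph_comp
    ((orientationPreserving_inversion 3).conj coords.toHomeomorph.onePointCongr)

theorem isEmbedding_closedCurve (hk : IsProperMap k) (hinj : Function.Injective k)
    (h0 : ∀ t, k t ≠ 0) : IsEmbedding (closedCurve k) := by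
  rw [← IsEmbedding.of_comp_iff (g := ((↑) : E 3 → S3)) OnePoint.isOpenEmbedding_coe.isEmbedding]
  convert ((coords.toHomeomorph.onePointCongr.trans (inversion ℂ)).trans
    coords.toHomeomorph.onePointCongr.symm).isEmbedding.comp (isEmbedding_compactification hk hinj)
  exact (inversion_comp_compactification h0).symm

theorem exists_continuous_pos_abs_mul_le {T B : Type*} [TopologicalSpace T] [TopologicalSpace B]
    [NormalSpace B] [ParacompactSpace B] [WeaklyLocallyCompactSpace B] {f : T → B}
    (hf : IsProperMap f) {z : T → ℝ} (hz : Continuous z) :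
    ∃ μ : C(B, ℝ), (∀ b, 0 < μ b) ∧ ∀ t, |z t| * μ (f t) ≤ 1 := by
  let V (b : B) : Set ℝ := {c | 0 < c ∧ ∀ t, f t = b → |z t| * c ≤ 1}
  have hconvex (b : B) : Convex ℝ (V b) := by
    intro c hc c' hc' α β hα hβ hαβ
    refine ⟨(convex_Ioi (0 : ℝ)) hc.1 hc'.1 hα hβ hαβ, fun t ht ↦ ?_⟩
    calc |z t| * (α • c + β • c') = α * (|z t| * c) + β * (|z t| * c') := by
          simp only [smul_eq_mul]; ring
      _ ≤ α * 1 + β * 1 := by gcongr; exacts [hc.2 t ht, hc'.2 t ht]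
      _ = 1 := by rw [← add_mul, hαβ, one_mul]
  have hlocal (b : B) : ∃ c : ℝ, ∀ᶠ b' in 𝓝 b, c ∈ V b' := by
    obtain ⟨C, hC, hCb⟩ := exists_compact_mem_nhds b
    obtain ⟨M, hM⟩ := ((hf.isCompact_preimage hC).image hz.abs).bddAbove
    refine ⟨(max M 1)⁻¹, ?_⟩
    filter_upwards [hCb] with b' hb'
    refine ⟨by positivity, fun t ht ↦ ?_⟩
    rw [← div_eq_mul_inv, div_le_one (by positivity)]
    exact (hM ⟨t, by rwa [Set.mem_preimage, ht], rfl⟩).trans (le_max_left _ _)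
  obtain ⟨μ, hμ⟩ := exists_continuous_forall_mem_convex_of_local_const hconvex hlocal
  exact ⟨μ, fun b ↦ (hμ b).1, fun t ↦ (hμ (f t)).2 t rfl⟩

theorem two_mul_crossingNumber_le_of_cone {α : S1 → S3} {S : Finset ℝ} (hk : IsProperMap k)
    (hinj : Function.Injective k) (hkα : KnotEquivalent (compactification k) α)
    (hS : IsRegularPlaneCurve (fun t ↦ (k t).1) S) (h0 : ∀ t, (k t).1 ≠ 0)
    (hcone : ∀ t, |(k t).2| ≤ ‖(k t).1‖) : 2 * crossingNumber α ≤ S.card := by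
  have hk0 (t : ℝ) : k t ≠ 0 := fun h ↦ h0 t (congrArg Prod.fst h)
  have hproj := verticalProjection_comp_closedCurve hcone
  have hsurj : Function.Surjective verticalProjection :=
    planeCoords.surjective.comp (Prod.fst_surjective.comp coords.surjective)
  refine le_trans ?_ (hS.two_mul_encard_multiplePoints_le h0)
  gcongr
  rw [← hproj]
  refine sInf_le ⟨closedCurve k, verticalProjection, isEmbedding_closedCurve hk hinj hk0,
    (knotEquivalent_closedCurve hk0).trans hkα, ⟨hsurj, ?_, fun w ↦ ?_, fun p q hpq h ↦ ?_⟩, rfl⟩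
  · rw [hproj]
    exact hS.finite_multiplePoints h0
  · rw [hproj]
    simpa [← planeCoords.eq_symm_apply] using
      hS.encard_fiber_closedPlaneCurve_le h0 (planeCoords.symm w)
  · rw [hproj] at h ⊢
    exact hS.transverseAt_closedPlaneCurve h0 hpq (planeCoords.injective h)

theorem two_mul_crossingNumber_le (hk : Function.Injective k) (hkk' : AmbientEquivalent 3 k k')
    (hcont : Continuous k') (hproper : IsProperMap fun t ↦ (k' t).1) {S : Finset ℝ}
    (hS : IsRegularPlaneCurve (fun t ↦ (k' t).1) S) :
    2 * crossingNumber (compactification k) ≤ S.card := by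
  obtain ⟨q, hq⟩ := (hS.contDiff.dense_compl_range_of_finrank_lt_finrank (by simp)).nonempty
  have hq0 (t : ℝ) : (k' t).1 - q ≠ 0 := sub_ne_zero.2 fun h ↦ hq ⟨t, h⟩
  have hproper' : IsProperMap fun t ↦ (k' t).1 - q :=
    (Homeomorph.subRight q).isProperMap.comp hproper
  obtain ⟨μ, hμpos, hμ⟩ := exists_continuous_pos_abs_mul_le hproper'
    (z := fun t ↦ (k' t).2 / ‖(k' t).1 - q‖) (by fun_prop (disch := simpa using hq0))
  have hequiv : AmbientEquivalent 3 k
      fun t ↦ ((k' t).1 - q, μ ((k' t).1 - q) * (k' t).2) := by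
    simpa [sub_eq_add_neg] using (hkk'.trans (.fst_add_comp_snd k' (c := fun _ ↦ -q)
      continuous_const)).trans (.snd_affine_comp_fst _ μ.continuous continuous_zero hμpos)
  refine two_mul_crossingNumber_le_of_cone ?_ (hequiv.injective hk) hequiv.knotEquivalent
    (hS.sub_const q) hq0 fun t ↦ ?_
  · exact isProperMap_of_comp_of_t2 (by fun_prop) continuous_fst hproper'
  · have := hμ t
    rw [abs_div, abs_norm, div_mul_eq_mul_div, div_le_one (norm_pos_iff.2 (hq0 t))] at this
    rwa [abs_mul, abs_of_pos (hμpos _), mul_comm]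

end Closing

/-! ### Straightening the ends of a curve -/

section Immersion

variable {F : Type*} [NormedAddCommGroup F] [NormedSpace ℝ F] {k : ℝ → F} {k' : F} {t : ℝ}

theorem eventually_mul_abs_sub_le_of_hasStrictDerivAt (hk : HasStrictDerivAt k k' t)
    (hk' : k' ≠ 0) : ∃ c > 0, ∀ᶠ p in 𝓝 (t, t), c * |p.1 - p.2| ≤ ‖k p.1 - k p.2‖ := by
  have hpos : 0 < ‖k'‖ / 2 := half_pos (norm_pos_iff.2 hk')
  refine ⟨‖k'‖ / 2, hpos, ?_⟩
  filter_upwards [hk.isLittleO.def hpos] with p hp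
  have hle := norm_sub_norm_le ((p.1 - p.2) • k') (k p.1 - k p.2)
  rw [norm_smul, norm_sub_rev _ (k p.1 - k p.2)] at hle
  simp only [ContinuousLinearMap.toSpanSingleton_apply, Real.norm_eq_abs] at hp hle
  linarith

/-- A continuously differentiable injective immersion of the real line in a normed space. -/
structure IsEmbeddedCurve (k : ℝ → F) : Prop where
  contDiff : ContDiff ℝ 1 k
  injective : Function.Injective k
  deriv_ne_zero : ∀ t, deriv k t ≠ 0

theorem IsEmbeddedCurve.clm_comp {G : Type*} [NormedAddCommGroup G] [NormedSpace ℝ G]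
    (hk : IsEmbeddedCurve k) (L : F →L[ℝ] G) (hL : Function.Injective L) :
    IsEmbeddedCurve (L ∘ k) := by
  refine ⟨L.contDiff.comp hk.contDiff, hL.comp hk.injective, fun t h ↦ hk.deriv_ne_zero t ?_⟩
  have hkt := (hk.contDiff.differentiable one_ne_zero t).hasDerivAt
  exact hL (((L.hasFDerivAt.comp_hasDerivAt t hkt).deriv.symm.trans h).trans (map_zero L).symm)

theorem IsEmbeddedCurve.exists_mul_abs_sub_le_norm_sub (hk : IsEmbeddedCurve k) {K : Set ℝ}
    (hK : IsCompact K) :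
    ∃ c > 0, ∀ s ∈ K, ∀ t ∈ K, c * |s - t| ≤ ‖k s - k t‖ := by
  suffices h : ∃ c > 0, ∀ p ∈ K ×ˢ K, c * |p.1 - p.2| ≤ ‖k p.1 - k p.2‖ by
    obtain ⟨c, hc, h⟩ := h
    exact ⟨c, hc, fun s hs t ht ↦ h (s, t) ⟨hs, ht⟩⟩
  refine (hK.prod hK).induction_on (p := fun A ↦ ∃ c > 0, ∀ p ∈ A, c * |p.1 - p.2| ≤
    ‖k p.1 - k p.2‖) ⟨1, one_pos, by simp⟩ ?_ ?_ ?_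
  · rintro A B hAB ⟨c, hc, h⟩
    exact ⟨c, hc, fun p hp ↦ h p (hAB hp)⟩
  · rintro A B ⟨a, ha, hA⟩ ⟨b, hb, hB⟩
    refine ⟨min a b, lt_min ha hb, ?_⟩
    rintro p (hp | hp)
    · exact (mul_le_mul_of_nonneg_right (min_le_left a b) (abs_nonneg _)).trans (hA p hp)
    · exact (mul_le_mul_of_nonneg_right (min_le_right a b) (abs_nonneg _)).trans (hB p hp)
  · rintro ⟨s, t⟩ -
    suffices h : ∃ c > 0, ∀ᶠ p in 𝓝 (s, t), c * |p.1 - p.2| ≤ ‖k p.1 - k p.2‖ by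
      obtain ⟨c, hc, h⟩ := h
      exact ⟨_, mem_nhdsWithin_of_mem_nhds h, c, hc, fun p hp ↦ hp⟩
    rcases eq_or_ne s t with rfl | hst
    · exact eventually_mul_abs_sub_le_of_hasStrictDerivAt
        (hk.contDiff.contDiffAt.hasStrictDerivAt one_ne_zero) (hk.deriv_ne_zero s)
    · have hpos : 0 < ‖k s - k t‖ := norm_pos_iff.2 (sub_ne_zero.2 (hk.injective.ne hst))
      refine ⟨‖k s - k t‖ / (|s - t| + 1), by positivity, ?_⟩
      have hkc := hk.contDiff.continuous
      refine (ContinuousAt.eventually_lt (x₀ := (s, t)) (by fun_prop) (by fun_prop) ?_).mono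
        fun _ h ↦ h.le
      rw [div_mul_eq_mul_div, div_lt_iff₀ (by positivity)]
      exact mul_lt_mul_of_pos_left (lt_add_one _) hpos

end Immersion

section TailSection

variable {f g : ℝ → ℝ} {T T₀ h : ℝ} {τ : ℝ → ℝ}

/-- `τ` inverts `f` on the ray `[T, ∞)`, which `f` maps onto `[h, ∞)`. Below `h`, where there is
nothing to invert, `τ` is constant. -/
structure IsTailSection (f : ℝ → ℝ) (T h : ℝ) (τ : ℝ → ℝ) : Prop where
  continuous : Continuous τ
  le_apply : ∀ ζ, T ≤ τ ζ
  eq_of_le : ∀ ζ ≤ h, τ ζ = T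
  map_apply : ∀ ζ, f (τ ζ) = max h ζ
  leftInverse : ∀ t, T ≤ t → τ (f t) = t

namespace IsTailSection

theorem map_eq (hτ : IsTailSection f T h τ) : f T = h := by
  rw [← hτ.eq_of_le h le_rfl, hτ.map_apply, max_self]

theorem le_map (hτ : IsTailSection f T h τ) {t : ℝ} (ht : T ≤ t) : h ≤ f t := by
  rw [← hτ.leftInverse t ht, hτ.map_apply]
  exact le_max_left _ _

theorem of_strictMonoOn (hf : Continuous f) (hmono : StrictMonoOn f (Set.Ici T))
    (htop : Tendsto f atTop atTop) : ∃ τ, IsTailSection f T (f T) τ := by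
  set g : Set.Ici T → Set.Ici (f T) := fun t ↦
    ⟨f t, hmono.monotoneOn Set.self_mem_Ici t.2 t.2⟩
  have hg : StrictMono g := fun s t hst ↦ hmono s.2 t.2 hst
  have hsurj : Function.Surjective g := by
    rintro ⟨y, hy⟩
    obtain ⟨t, ht, rfl⟩ := isPreconnected_Ici.intermediate_value_Ici Set.self_mem_Ici
      (le_principal_iff.2 (Ici_mem_atTop T)) hf.continuousOn htop hy
    exact ⟨⟨t, ht⟩, rfl⟩
  set e := hg.orderIsoOfSurjective g hsurj
  have he : ∀ y, f (e.symm y) = y := fun y ↦ congrArg Subtype.val (e.apply_symm_apply y)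
  have hinj : ∀ ζ t, T ≤ t → max (f T) ζ = f t → (e.symm (Set.projIci (f T) ζ) : ℝ) = t :=
    fun ζ t ht h ↦ hmono.injOn (e.symm _).2 ht (by rw [he, Set.coe_projIci, h])
  exact ⟨fun ζ ↦ e.symm (Set.projIci (f T) ζ),
    continuous_subtype_val.comp (e.symm.continuous.comp
      ((continuous_const.max continuous_id).subtype_mk _)),
    fun ζ ↦ (e.symm _).2, fun ζ hζ ↦ hinj ζ T le_rfl (max_eq_left hζ),
    fun ζ ↦ he _, fun t ht ↦ hinj _ t ht (max_eq_right (g ⟨t, ht⟩).2)⟩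

theorem exists_of_abs_le (hf : Continuous f) (hmono : StrictMonoOn f (Set.Ici T₀))
    (htop : Tendsto f atTop atTop) (hh : |f T₀| ≤ h) :
    ∃ T ≥ T₀, (∃ τ, IsTailSection f T h τ) ∧ ∀ t ∈ Set.Icc T₀ T, |f t| ≤ h := by
  rw [abs_le] at hh
  obtain ⟨T, hT, rfl⟩ := isPreconnected_Ici.intermediate_value_Ici Set.self_mem_Ici
    (le_principal_iff.2 (Ici_mem_atTop T₀)) hf.continuousOn htop hh.2
  exact ⟨T, hT, of_strictMonoOn hf (hmono.mono (Set.Ici_subset_Ici.2 hT)) htop, fun t ht ↦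
    abs_le.2 ⟨hh.1.trans (hmono.monotoneOn Set.self_mem_Ici ht.1 ht.1),
      hmono.monotoneOn ht.1 hT ht.2⟩⟩

theorem exists_pair (hf : Continuous f) (hg : Continuous g) (hgf : ∀ t, |g t| = |f (-t)|)
    (hf_mono : ∀ᶠ T in atTop, StrictMonoOn f (Set.Ici T))
    (hg_mono : ∀ᶠ T in atTop, StrictMonoOn g (Set.Ici T))
    (hf_top : Tendsto f atTop atTop) (hg_top : Tendsto g atTop atTop) :
    ∃ T₁ T₂ h σ τ, T₁ < T₂ ∧ IsTailSection g (-T₁) h σ ∧ IsTailSection f T₂ h τ ∧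
      ∀ t ∈ Set.Icc T₁ T₂, |f t| ≤ h := by
  obtain ⟨T, hfT, hgT, hT⟩ := (hf_mono.and (hg_mono.and (eventually_gt_atTop 0))).exists
  obtain ⟨h, hh⟩ := (isCompact_Icc (a := -T) (b := T)).bddAbove_image hf.abs.continuousOn
  have hmid : ∀ t ∈ Set.Icc (-T) T, |f t| ≤ h := fun t ht ↦ hh ⟨t, ht, rfl⟩
  obtain ⟨T₂, hT₂, ⟨τ, hτ⟩, hright⟩ := exists_of_abs_le hf hfT hf_top
    (hmid T ⟨by linarith, le_rfl⟩)
  obtain ⟨T₁, hT₁, ⟨σ, hσ⟩, hleft⟩ := exists_of_abs_le hg hgT hg_top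
    ((hgf T).trans_le (hmid (-T) ⟨le_rfl, by linarith⟩))
  refine ⟨-T₁, T₂, h, σ, τ, by linarith, by rwa [neg_neg], hτ, fun t ht ↦ ?_⟩
  rcases le_total t (-T) with h₁ | h₁
  · have := hleft (-t) ⟨by linarith, by linarith [ht.1]⟩
    rwa [hgf, neg_neg] at this
  · rcases le_total t T with h₂ | h₂
    · exact hmid t ⟨h₁, h₂⟩
    · exact hright t ⟨h₂, ht.2⟩

end IsTailSection

end TailSection

section Straightening

variable {n : ℕ} {z : ℝ → ℝ} {T₁ T₂ h : ℝ} {σ τ : ℝ → ℝ} {u : ℂ → ℂ}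

open Set (projIcc)

/-- The two ends of every space curve `(P, z)` without double points can be turned into vertical
rays, while between the parameters `T₁` and `T₂` the curve is only multiplied horizontally by a
complex number, which depends continuously on `P`. -/
structure IsStraightening (n : ℕ) (z : ℝ → ℝ) {T₁ T₂ : ℝ} (hT : T₁ ≤ T₂) (u : ℂ → ℂ) : Prop where
  abs_sub_le : ∀ s t, |z (projIcc T₁ T₂ hT s) - z (projIcc T₁ T₂ hT t)| ≤ |z s - z t|
  continuousAt : ∀ P : ℝ → ℂ, (Function.Injective fun t ↦ (P t, z t)) →
    ContinuousAt u (P T₂ - P T₁)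
  ne_zero : ∀ P : ℝ → ℂ, (Function.Injective fun t ↦ (P t, z t)) → u (P T₂ - P T₁) ≠ 0
  ambientEquivalent : ∀ P : ℝ → ℂ, Continuous P → (Function.Injective fun t ↦ (P t, z t)) →
    AmbientEquivalent n (fun t ↦ (P t, z t)) fun t ↦
      (P (projIcc T₁ T₂ hT t) * u (P T₂ - P T₁), z t)

theorem cases_mem_Icc (t : ℝ) : t ≤ T₁ ∨ t ∈ Set.Icc T₁ T₂ ∨ T₂ ≤ t := by
  rcases le_total t T₁ with h₁ | h₁
  · exact .inl h₁
  · exact .inr ((le_total t T₂).imp_left fun h₂ ↦ ⟨h₁, h₂⟩)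

theorem abs_comp_projIcc_sub_le (hT : T₁ ≤ T₂) (hz : ∀ t ∈ Set.Icc T₁ T₂, |z t| ≤ h)
    (h₁ : ∀ t ≤ T₁, z T₁ = h ∧ h ≤ z t ∨ z T₁ = -h ∧ z t ≤ -h)
    (h₂ : ∀ t, T₂ ≤ t → z T₂ = h ∧ h ≤ z t) (s t : ℝ) :
    |z (projIcc T₁ T₂ hT s) - z (projIcc T₁ T₂ hT t)| ≤ |z s - z t| := by
  have hh : -h ≤ h := neg_le_self ((abs_nonneg _).trans (hz T₁ ⟨le_rfl, hT⟩))
  have hclamp : ∀ t, z (projIcc T₁ T₂ hT t) = projIcc (-h) h hh (z t) := by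
    intro t
    rcases cases_mem_Icc (T₁ := T₁) (T₂ := T₂) t with ht | ht | ht
    · rw [Set.projIcc_of_le_left hT ht]
      rcases h₁ t ht with ⟨h₀, ht'⟩ | ⟨h₀, ht'⟩
      · rw [Set.projIcc_of_right_le hh ht', h₀]
      · rw [Set.projIcc_of_le_left hh ht', h₀]
    · rw [Set.projIcc_of_mem hT ht, Set.projIcc_of_mem hh (abs_le.1 (hz t ht))]
    · rw [Set.projIcc_of_right_le hT ht, (h₂ t ht).1, Set.projIcc_of_right_le hh (h₂ t ht).2]
  rw [hclamp, hclamp]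
  exact Set.abs_projIcc_sub_projIcc hh

theorem IsStraightening.of_even (hT : T₁ < T₂) (hσ : IsTailSection (fun t ↦ z (-t)) (-T₁) h σ)
    (hτ : IsTailSection z T₂ h τ) (hz : ∀ t ∈ Set.Icc T₁ T₂, |z t| ≤ h) :
    IsStraightening n z hT.le (·⁻¹) := by
  have hzT₁ : z T₁ = h := by simpa using hσ.map_eq
  have hne : ∀ P : ℝ → ℂ, (Function.Injective fun t ↦ (P t, z t)) →
      ∀ ζ, P (τ ζ) - P (-σ ζ) ≠ 0 := by
    intro P hinj ζ h₀
    have := hinj (Prod.ext (sub_eq_zero.1 h₀) ((hτ.map_apply ζ).trans (hσ.map_apply ζ).symm))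
    linarith [hτ.le_apply ζ, hσ.le_apply ζ]
  have hW : ∀ P : ℝ → ℂ, (Function.Injective fun t ↦ (P t, z t)) → P T₂ - P T₁ ≠ 0 :=
    fun P hinj h₀ ↦ hT.ne' (hinj (Prod.ext (sub_eq_zero.1 h₀) (hτ.map_eq.trans hzT₁.symm)))
  refine ⟨abs_comp_projIcc_sub_le hT.le hz
    (fun t ht ↦ .inl ⟨hzT₁, by simpa using hσ.le_map (neg_le_neg ht)⟩)
    fun t ht ↦ ⟨hτ.map_eq, hτ.le_map ht⟩, fun P hinj ↦ continuousAt_inv₀ (hW P hinj),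
    fun P hinj ↦ inv_ne_zero (hW P hinj), fun P hP hinj ↦ ?_⟩
  have hσc := hσ.continuous
  have hτc := hτ.continuous
  -- Move the left end to the vertical axis, and then the right end, which reaches the same
  -- heights, to the vertical line through `1`.
  have key := ((AmbientEquivalent.fst_add_comp_snd (n := n) (fun t ↦ (P t, z t))
    (c := fun ζ ↦ -P (-σ ζ)) (by fun_prop)).trans (.fst_mul_comp_snd _
      (u := fun ζ ↦ (P (τ ζ) - P (-σ ζ))⁻¹) (.inv₀ (by fun_prop) (hne P hinj))
      fun ζ ↦ inv_ne_zero (hne P hinj ζ))).trans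
    (.fst_add_comp_snd _ (c := fun _ ↦ P T₁ * (P T₂ - P T₁)⁻¹) continuous_const)
  convert key using 3 with t
  rcases cases_mem_Icc (T₁ := T₁) (T₂ := T₂) t with ht | ht | ht
  · have hσt : σ (z t) = -t := by simpa using hσ.leftInverse _ (neg_le_neg ht)
    rw [Set.projIcc_of_le_left hT.le ht, hσt, neg_neg]
    ring
  · have hle := (abs_le.1 (hz t ht)).2
    rw [Set.projIcc_of_mem hT.le ht, hτ.eq_of_le _ hle, hσ.eq_of_le _ hle, neg_neg]
    ring
  · have h₀ := hne P hinj (z t)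
    rw [hτ.leftInverse t ht] at h₀ ⊢
    rw [Set.projIcc_of_right_le hT.le ht, ← sub_eq_add_neg, mul_inv_cancel₀ h₀,
      ← mul_inv_cancel₀ (hW P hinj)]
    ring

theorem IsStraightening.of_odd (hT : T₁ ≤ T₂) (hσ : IsTailSection (fun t ↦ -z (-t)) (-T₁) h σ)
    (hτ : IsTailSection z T₂ h τ) (hz : ∀ t ∈ Set.Icc T₁ T₂, |z t| ≤ h) :
    IsStraightening n z hT fun _ ↦ 1 := by
  have hzT₁ : z T₁ = -h := by simpa [neg_eq_iff_eq_neg] using hσ.map_eq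
  have hleft : ∀ t ≤ T₁, z t ≤ -h := fun t ht ↦ by
    simpa [le_neg] using hσ.le_map (neg_le_neg ht)
  refine ⟨abs_comp_projIcc_sub_le hT hz (fun t ht ↦ .inr ⟨hzT₁, hleft t ht⟩)
    fun t ht ↦ ⟨hτ.map_eq, hτ.le_map ht⟩, fun _ _ ↦ continuousAt_const,
    fun _ _ ↦ one_ne_zero, fun P hP _ ↦ ?_⟩
  have hh : 0 ≤ h := (abs_nonneg _).trans (hz T₁ ⟨le_rfl, hT⟩)
  have hσc := hσ.continuous
  have hτc := hτ.continuous
  convert AmbientEquivalent.fst_add_comp_snd (n := n) (fun t ↦ (P t, z t))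
    (c := fun ζ ↦ P T₂ - P (τ ζ) + (P T₁ - P (-σ (-ζ)))) (by fun_prop) using 3 with t
  rcases cases_mem_Icc (T₁ := T₁) (T₂ := T₂) t with ht | ht | ht
  · have hσt : σ (-z t) = -t := by simpa using hσ.leftInverse _ (neg_le_neg ht)
    rw [Set.projIcc_of_le_left hT ht, hσt, neg_neg, hτ.eq_of_le _ (by linarith [hleft t ht])]
    ring
  · have hzt := abs_le.1 (hz t ht)
    rw [Set.projIcc_of_mem hT ht, hτ.eq_of_le _ hzt.2, hσ.eq_of_le _ (neg_le.1 hzt.1), neg_neg]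
    ring
  · rw [Set.projIcc_of_right_le hT ht, hτ.leftInverse t ht,
      hσ.eq_of_le _ (by linarith [hτ.le_map ht]), neg_neg]
    ring

theorem eventually_strictMonoOn_eval {p : ℝ[X]} (hd : 0 < p.natDegree)
    (hl : 0 < p.leadingCoeff) : ∀ᶠ T in atTop, StrictMonoOn (fun t ↦ p.eval t) (Set.Ici T) := by
  have hpos : ∀ᶠ t in atTop, 0 < p.derivative.eval t := by
    have hlead : 0 < p.derivative.leadingCoeff := by
      rw [leadingCoeff_derivative]
      positivity
    rcases Nat.eq_zero_or_pos p.derivative.natDegree with h₀ | h₀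
    · rw [eq_C_of_natDegree_eq_zero h₀] at hlead ⊢
      exact Eventually.of_forall fun t ↦ by simpa using hlead
    · exact (tendsto_atTop_of_leadingCoeff_nonneg _ (natDegree_pos_iff_degree_pos.1 h₀)
        hlead.le).eventually_gt_atTop 0
  filter_upwards [eventually_forall_ge_atTop.2 hpos] with T hT
  refine strictMonoOn_of_deriv_pos (convex_Ici T) p.continuous.continuousOn fun t ht ↦ ?_
  rw [interior_Ici] at ht
  exact p.deriv.symm ▸ hT t ht.le

theorem exists_isStraightening (n : ℕ) {p : ℝ[X]} (hd : 0 < p.natDegree)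
    (hl : 0 < p.leadingCoeff) :
    ∃ (T₁ T₂ : ℝ) (hT : T₁ ≤ T₂) (u : ℂ → ℂ), IsStraightening n (fun t ↦ p.eval t) hT u := by
  have hpair : ∀ q : ℝ[X], q.natDegree = p.natDegree → 0 < q.leadingCoeff →
      (∀ t, |q.eval t| = |p.eval (-t)|) →
      ∃ T₁ T₂ h σ τ, T₁ < T₂ ∧ IsTailSection (fun t ↦ q.eval t) (-T₁) h σ ∧
        IsTailSection (fun t ↦ p.eval t) T₂ h τ ∧ ∀ t ∈ Set.Icc T₁ T₂, |p.eval t| ≤ h := by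
    intro q hq hql hqp
    have hqd := hq ▸ hd
    exact IsTailSection.exists_pair p.continuous q.continuous hqp
      (eventually_strictMonoOn_eval hd hl) (eventually_strictMonoOn_eval hqd hql)
      (tendsto_atTop_of_leadingCoeff_nonneg _ (natDegree_pos_iff_degree_pos.1 hd) hl.le)
      (tendsto_atTop_of_leadingCoeff_nonneg _ (natDegree_pos_iff_degree_pos.1 hqd) hql.le)
  have hl' : (p.comp (-X)).leadingCoeff = p.leadingCoeff * (-1) ^ p.natDegree := by
    rw [leadingCoeff_comp (by simp)]
    simp
  rcases Nat.even_or_odd p.natDegree with heven | hodd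
  · obtain ⟨T₁, T₂, h, σ, τ, hT, hσ, hτ, hz⟩ := hpair (p.comp (-X)) (by simp [natDegree_comp])
      (by simpa [hl', heven.neg_one_pow]) (by simp)
    exact ⟨T₁, T₂, hT.le, _, .of_even hT (by simpa using hσ) hτ hz⟩
  · obtain ⟨T₁, T₂, h, σ, τ, hT, hσ, hτ, hz⟩ := hpair (-p.comp (-X)) (by simp [natDegree_comp])
      (by simpa [hl', hodd.neg_one_pow]) (by simp)
    exact ⟨T₁, T₂, hT.le, _, .of_odd hT.le (by simpa using hσ) hτ hz⟩

end Straightening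

section Stability

variable {n : ℕ} {z : ℝ → ℝ} {T₁ T₂ : ℝ} {hT : T₁ ≤ T₂} {u : ℂ → ℂ}

open Set (projIcc)

theorem norm_mul_sub_mul_sub_le (a b p q p' q' : ℂ) :
    ‖(p' * b - p * a) - (q' * b - q * a)‖ ≤
      ‖b - a‖ * ‖p - q‖ + ‖b‖ * ‖(p' - p) - (q' - q)‖ := by
  rw [← norm_mul, ← norm_mul]
  exact (norm_add_le _ _).trans_eq' (by ring_nf)

theorem min_mul_norm_sub_le (a p q : ℂ) {x y x' y' : ℝ} (h : |x - y| ≤ |x' - y'|) :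
    min ‖a‖ 1 * ‖(p, x) - (q, y)‖ ≤ ‖(p * a, x') - (q * a, y')‖ := by
  rw [Prod.mk_sub_mk, Prod.mk_sub_mk, Prod.norm_mk, Prod.norm_mk, ← sub_mul, norm_mul,
    mul_max_of_nonneg _ _ (by positivity), mul_comm ‖p - q‖]
  refine max_le_max (by gcongr; exact min_le_left _ _) ?_
  calc min ‖a‖ 1 * |x - y| ≤ 1 * |x - y| := by gcongr; exact min_le_right _ _
    _ ≤ |x' - y'| := by rwa [one_mul]

theorem exists_pos_forall_norm_sub_add_le {w : ℂ} (hu : ContinuousAt u w) (c L : ℝ) {η : ℝ}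
    (hη : 0 < η) :
    ∃ δ > 0, ∀ w', ‖w' - w‖ ≤ δ * L → ‖u w' - u w‖ + ‖u w'‖ * (δ / c) ≤ η := by
  have hcont : ContinuousAt (fun q : ℂ × ℝ ↦ ‖u q.1 - u w‖ + ‖u q.1‖ * (q.2 / c)) (w, 0) := by
    have : ContinuousAt (fun q : ℂ × ℝ ↦ u q.1) (w, 0) := hu.comp continuousAt_fst
    fun_prop
  obtain ⟨r, hr, hball⟩ := Metric.eventually_nhds_iff.1
    (hcont.eventually_lt continuousAt_const (by simpa using hη))
  refine ⟨r / (|L| + 2), by positivity, fun w' hw' ↦ (@hball (w', _) ?_).le⟩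
  rw [Prod.dist_eq, max_lt_iff, dist_eq_norm, dist_zero_right, Real.norm_of_nonneg (by positivity)]
  refine ⟨hw'.trans_lt ?_, div_lt_self hr (by linarith [abs_nonneg L])⟩
  rw [div_mul_eq_mul_div, div_lt_iff₀ (by positivity)]
  exact mul_lt_mul_of_pos_left (by linarith [le_abs_self L]) hr

theorem IsStraightening.exists_forall_ambientEquivalent (hz : IsStraightening n z hT u)
    {P : ℝ → ℂ} (hP : Continuous P) (hinj : Function.Injective fun t ↦ (P t, z t)) {c : ℝ}
    (hc : 0 < c) (hlow : ∀ s ∈ Set.Icc T₁ T₂, ∀ t ∈ Set.Icc T₁ T₂,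
      c * |s - t| ≤ ‖(P s, z s) - (P t, z t)‖) :
    ∃ δ > 0, ∀ Q : ℝ → ℂ, Continuous Q → (Function.Injective fun t ↦ (Q t, z t)) →
      (∀ s ∈ Set.Icc T₁ T₂, ∀ t ∈ Set.Icc T₁ T₂, ‖(Q s - P s) - (Q t - P t)‖ ≤ δ * |s - t|) →
      AmbientEquivalent n (fun t ↦ (P t, z t)) fun t ↦ (Q t, z t) := by
  obtain ⟨ε, hε, hclose⟩ := AmbientEquivalent.exists_of_norm_sub_sub_le (ℂ × ℝ) n ℝ
  set a := u (P T₂ - P T₁)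
  have hm : 0 < min ‖a‖ 1 := lt_min (norm_pos_iff.2 (hz.ne_zero P hinj)) one_pos
  obtain ⟨δ, hδ, hu⟩ := exists_pos_forall_norm_sub_add_le (hz.continuousAt P hinj) c (T₂ - T₁)
    (mul_pos hε hm)
  refine ⟨δ, hδ, fun Q hQ hQinj hQP ↦ ?_⟩
  set b := u (Q T₂ - Q T₁)
  have hab : ‖b - a‖ + ‖b‖ * (δ / c) ≤ ε * min ‖a‖ 1 := by
    refine hu _ ?_
    have := hQP T₂ ⟨hT, le_rfl⟩ T₁ ⟨le_rfl, hT⟩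
    rwa [abs_of_nonneg (sub_nonneg.2 hT), sub_sub_sub_comm] at this
  refine ((hz.ambientEquivalent P hP hinj).trans (hclose _ _ fun s t ↦ ?_)).trans
    (hz.ambientEquivalent Q hQ hQinj).symm
  obtain ⟨s', hs, hs'⟩ : ∃ s' ∈ Set.Icc T₁ T₂, s' = projIcc T₁ T₂ hT s := ⟨_, (projIcc ..).2, rfl⟩
  obtain ⟨t', ht, ht'⟩ : ∃ t' ∈ Set.Icc T₁ T₂, t' = projIcc T₁ T₂ hT t := ⟨_, (projIcc ..).2, rfl⟩
  have hzst := hz.abs_sub_le s t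
  rw [← hs', ← ht'] at hzst ⊢
  set N := ‖(P s', z s') - (P t', z t')‖
  have hdist : |s' - t'| ≤ N / c := by
    rw [le_div_iff₀ hc, mul_comm]
    exact hlow s' hs t' ht
  calc _ = ‖(Q s' * b - P s' * a) - (Q t' * b - P t' * a)‖ := by simp [Prod.norm_def, a, b]
    _ ≤ ‖b - a‖ * ‖P s' - P t'‖ + ‖b‖ * ‖(Q s' - P s') - (Q t' - P t')‖ :=
      norm_mul_sub_mul_sub_le a b _ _ _ _
    _ ≤ ‖b - a‖ * N + ‖b‖ * (δ * (N / c)) := by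
      gcongr
      · exact norm_fst_le ((P s', z s') - (P t', z t'))
      · exact (hQP s' hs t' ht).trans (by gcongr)
    _ = (‖b - a‖ + ‖b‖ * (δ / c)) * N := by ring
    _ ≤ ε * (min ‖a‖ 1 * N) := by
      rw [← mul_assoc]
      gcongr
    _ ≤ ε * ‖(P s' * a, z s) - (P t' * a, z t)‖ := by
      gcongr
      exact min_mul_norm_sub_le a _ _ hzst

end Stability

/-! ### Double points and resultants -/

section DividedDifference

variable {R : Type*} [CommRing R]

theorem coeff_iterate_divX (p : R[X]) (j i : ℕ) : (divX^[j] p).coeff i = p.coeff (i + j) := by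
  induction j generalizing i with
  | zero => rfl
  | succ j ih => rw [Function.iterate_succ_apply', coeff_divX, ih, add_right_comm, add_assoc]

theorem natDegree_iterate_divX (p : R[X]) (j : ℕ) :
    (divX^[j] p).natDegree = p.natDegree - j := by
  induction j with
  | zero => rfl
  | succ j ih =>
    rw [Function.iterate_succ_apply', natDegree_divX_eq_natDegree_tsub_one, ih, Nat.sub_sub]

/-- The divided difference `(p(s) - p(t)) / (s - t)` as a polynomial in `t` whose coefficients are
polynomials in `s`. -/
def divDiff (p : R[X]) : R[X][X] :=
  ∑ j ∈ Finset.range p.natDegree, C (divX^[j + 1] p) * X ^ j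

theorem iterate_divX_eq_zero {p : R[X]} {j : ℕ} (hj : p.natDegree < j) : divX^[j] p = 0 := by
  ext i
  rw [coeff_iterate_divX, coeff_zero, coeff_eq_zero_of_natDegree_lt (by omega)]

theorem coeff_divDiff (p : R[X]) (j : ℕ) : (divDiff p).coeff j = divX^[j + 1] p := by
  simp only [divDiff, finsetSum_coeff, coeff_C_mul, coeff_X_pow, mul_ite, mul_one, mul_zero,
    Finset.sum_ite_eq, Finset.mem_range, ite_eq_left_iff, not_lt]
  exact fun hj ↦ (iterate_divX_eq_zero (Nat.lt_succ_of_le hj)).symm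

theorem natDegree_divDiff_le (p : R[X]) : (divDiff p).natDegree ≤ p.natDegree - 1 :=
  natDegree_le_iff_coeff_eq_zero.2 fun j hj ↦ by
    rw [coeff_divDiff, iterate_divX_eq_zero (by omega)]

theorem C_X_sub_X_mul_divDiff (p : R[X]) : (C X - X) * divDiff p = C p - p.map C := by
  ext1 j
  have h : X * (divDiff p).coeff j = divX^[j] p - C (p.coeff j) := by
    rw [coeff_divDiff, Function.iterate_succ_apply', eq_sub_iff_add_eq, ← zero_add j,
      ← coeff_iterate_divX, zero_add, mul_comm, divX_mul_X_add]
  rw [sub_mul, coeff_sub, coeff_C_mul, h, coeff_sub, coeff_map]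
  cases j with
  | zero => simp
  | succ j => simp [coeff_divDiff]

theorem sub_mul_evalEval_divDiff (p : R[X]) (s t : R) :
    (s - t) * (divDiff p).evalEval s t = p.eval s - p.eval t := by
  simpa [evalEval_C, evalEval_map_C] using congrArg (evalEval s t) (C_X_sub_X_mul_divDiff p)

theorem map_evalRingHom_zero_divDiff (p : R[X]) :
    (divDiff p).map (evalRingHom 0) = p.divX := by
  ext j
  rw [coeff_map, coeff_divDiff, coe_evalRingHom, ← coeff_zero_eq_eval_zero, coeff_iterate_divX,
    zero_add, coeff_divX]

end DividedDifference

section Resultant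

variable {R : Type*} [CommRing R] {m n : ℕ}

theorem natDegree_det_le {ι : Type*} [Fintype ι] [DecidableEq ι] (M : Matrix ι ι R[X])
    (c w : ι → ℕ) (h : ∀ i j, M i j ≠ 0 → (M i j).natDegree + w i ≤ c j) :
    M.det.natDegree ≤ ∑ j, c j - ∑ i, w i := by
  rw [Matrix.det_apply]
  refine natDegree_sum_le_of_forall_le _ _ fun σ _ ↦ (natDegree_smul_le _ _).trans ?_
  by_cases hσ : ∃ i, M (σ i) i = 0
  · obtain ⟨i, hi⟩ := hσ
    have hprod : ∏ i, M (σ i) i = 0 := Finset.prod_eq_zero (Finset.mem_univ i) hi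
    simp [hprod]
  · push Not at hσ
    refine (natDegree_prod_le _ _).trans (Nat.le_sub_of_add_le ?_)
    rw [← Equiv.sum_comp σ w, ← Finset.sum_add_distrib]
    exact Finset.sum_le_sum fun i _ ↦ h _ _ (hσ i)

theorem sum_range_add_sum_range (m n : ℕ) :
    ∑ j ∈ Finset.range m, (n + j) + ∑ j ∈ Finset.range n, (m + j) =
      m * n + ∑ i ∈ Finset.range (m + n), i := by
  rw [Finset.sum_range_add (fun i ↦ i) m n, Finset.sum_add_distrib, Finset.sum_const,
    Finset.card_range, smul_eq_mul]
  ring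

theorem natDegree_resultant_le {f g : R[X][X]}
    (hf : ∀ j ≤ m, (f.coeff j).natDegree + j ≤ m) (hg : ∀ j ≤ n, (g.coeff j).natDegree + j ≤ n) :
    (f.resultant g m n).natDegree ≤ m * n := by
  let c : Fin (m + n) → ℕ := Fin.addCases (fun j : Fin m ↦ n + j) (fun j : Fin n ↦ m + j)
  have hc : ∑ j, c j = m * n + ∑ i : Fin (m + n), (i : ℕ) := by
    rw [Fin.sum_univ_add, Fin.sum_univ_eq_sum_range (fun i ↦ i)]
    simp only [c, Fin.addCases_left, Fin.addCases_right]
    rw [Fin.sum_univ_eq_sum_range (fun j ↦ n + j), Fin.sum_univ_eq_sum_range (fun j ↦ m + j)]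
    exact sum_range_add_sum_range m n
  refine (natDegree_det_le (sylvester f g m n) c (fun i ↦ i) fun i j hij ↦ ?_).trans_eq
    (by rw [hc, Nat.add_sub_cancel])
  induction j using Fin.addCases with
  | left j =>
    simp only [sylvester, Matrix.of_apply, Fin.addCases_left, c, Set.mem_Icc] at hij ⊢
    split_ifs at hij ⊢ with h
    · have := hg (i - j) (by omega)
      omega
    · exact absurd rfl hij
  | right j =>
    simp only [sylvester, Matrix.of_apply, Fin.addCases_right, c, Set.mem_Icc] at hij ⊢
    split_ifs at hij ⊢ with h
    · have := hf (i - j) (by omega)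
      omega
    · exact absurd rfl hij

/-- The resultant of the divided differences of `x` and `y`, of formal degrees `m` and `n`. The
parameter values of the double points of the plane curve `(x, y)` are among its roots. -/
def doublePointPoly (m n : ℕ) (x y : R[X]) : R[X] :=
  (divDiff x).resultant (divDiff y) m n

theorem natDegree_doublePointPoly_le {x y : R[X]} (hx : x.natDegree ≤ m + 1)
    (hy : y.natDegree ≤ n + 1) : (doublePointPoly m n x y).natDegree ≤ m * n := by
  refine natDegree_resultant_le (fun j hj ↦ ?_) (fun j hj ↦ ?_) <;>
  · rw [coeff_divDiff, natDegree_iterate_divX]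
    omega

theorem eval_doublePointPoly_eq_zero [IsDomain R] {x y : R[X]} (hx : x.natDegree ≤ m + 1)
    (hy : y.natDegree ≤ n + 1) (hm : m ≠ 0) {s t : R} (hst : s ≠ t)
    (hxst : x.eval s = x.eval t) (hyst : y.eval s = y.eval t) :
    (doublePointPoly m n x y).eval s = 0 := by
  have hzero : ∀ {p : R[X]}, p.eval s = p.eval t → (divDiff p).evalEval s t = 0 := fun {p} hp ↦
    (mul_eq_zero.1 ((sub_mul_evalEval_divDiff p s t).trans (sub_eq_zero.2 hp))).resolve_left
      (sub_ne_zero.2 hst)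
  obtain ⟨p, q, -, -, h⟩ := exists_mul_add_mul_eq_C_resultant (divDiff x) (divDiff y)
    ((natDegree_divDiff_le x).trans (Nat.sub_le_of_le_add hx))
    ((natDegree_divDiff_le y).trans (Nat.sub_le_of_le_add hy)) (Or.inl hm)
  simpa [evalEval_C, hzero hxst, hzero hyst, doublePointPoly, eq_comm] using
    congrArg (evalEval s t) h

theorem eval_zero_doublePointPoly (m n : ℕ) (x y : R[X]) :
    (doublePointPoly m n x y).eval 0 = x.divX.resultant y.divX m n := by
  rw [doublePointPoly, ← coe_evalRingHom, ← resultant_map_map, map_evalRingHom_zero_divDiff,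
    map_evalRingHom_zero_divDiff]

end Resultant

section AddQuadratic

/-- The perturbation `p + a X + b X²` of a polynomial; the terms of degree at most two are already
enough to put a plane curve in general position. -/
def addQuadratic {R : Type*} [Semiring R] (p : R[X]) (a b : R) : R[X] :=
  p + C a * X + C b * X ^ 2

theorem coeff_divX_addQuadratic {R : Type*} [Semiring R] (p : R[X]) (a b : R) (j : ℕ) :
    (addQuadratic p a b).divX.coeff j =
      p.coeff (j + 1) + (if j = 0 then a else 0) + if j = 1 then b else 0 := by
  simp [addQuadratic, coeff_X_pow, coeff_C]

theorem divX_addQuadratic {R : Type*} [Semiring R] (p : R[X]) (a b : R) :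
    (addQuadratic p a b).divX = (addQuadratic p 0 b).divX + C a := by
  ext j
  rw [coeff_add, coeff_divX_addQuadratic, coeff_divX_addQuadratic, coeff_C, ite_self, add_zero,
    add_right_comm]

theorem natDegree_addQuadratic_le {R : Type*} [Semiring R] (p : R[X]) (a b : R) :
    (addQuadratic p a b).natDegree ≤ max p.natDegree 2 := by
  refine natDegree_add_le_of_degree_le (natDegree_add_le_of_degree_le (le_max_left _ _) ?_) ?_
  · exact (natDegree_C_mul_le a X).trans (natDegree_X_le.trans (le_max_of_le_right one_le_two))
  · exact (natDegree_C_mul_X_pow_le b 2).trans (le_max_right _ _)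

variable {m n : ℕ}

theorem natDegree_divX_addQuadratic {R : Type*} [Semiring R] {p : R[X]}
    (hp : max p.natDegree 2 = m + 1) {b : R} (hb : p.coeff 2 + b ≠ 0) (a : R) :
    (addQuadratic p a b).divX.natDegree = m := by
  refine natDegree_eq_of_le_of_coeff_ne_zero
    (natDegree_divX_eq_natDegree_tsub_one.trans_le
      (Nat.sub_le_of_le_add ((natDegree_addQuadratic_le p a b).trans_eq hp))) ?_
  rw [coeff_divX_addQuadratic]
  rcases eq_or_ne m 1 with rfl | hm
  · simpa using hb
  · have hd : p.natDegree = m + 1 := by omega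
    rw [if_neg (by omega), if_neg hm, add_zero, add_zero, ← hd]
    exact leadingCoeff_ne_zero.2 (by rintro rfl; simp at hd)

theorem continuous_resultant {T R : Type*} [TopologicalSpace T] [CommRing R] [TopologicalSpace R]
    [IsTopologicalRing R] {f g : T → R[X]} (hf : ∀ j, Continuous fun p ↦ (f p).coeff j)
    (hg : ∀ j, Continuous fun p ↦ (g p).coeff j) (m n : ℕ) :
    Continuous fun p ↦ (f p).resultant (g p) m n := by
  refine Continuous.matrix_det (continuous_matrix fun i j ↦ ?_)
  induction j using Fin.addCases with
  | left j =>
    simp only [sylvester, Matrix.of_apply, Fin.addCases_left]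
    split_ifs <;> fun_prop
  | right j =>
    simp only [sylvester, Matrix.of_apply, Fin.addCases_right]
    split_ifs <;> fun_prop

theorem finite_setOf_resultant_add_C_eq_zero {f g : ℝ[X]} (hg : g ≠ 0) :
    {a : ℝ | (f + C a).resultant g = 0}.Finite := by
  have hroots : {τ : ℂ | aeval τ g = 0}.Finite :=
    (g.aroots ℂ).toFinset.finite_toSet.subset fun τ hτ ↦ by simpa [hg] using hτ
  refine (hroots.image fun τ ↦ (-aeval τ f).re).subset fun a ha ↦ ?_
  have hnot := (resultant_eq_zero_iff.1 ha).2
  simp only [isCoprime_iff_aeval_ne_zero_of_isAlgClosed ℝ ℂ, map_add, aeval_C,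
    not_forall, not_or, not_not] at hnot
  obtain ⟨τ, hfτ, hgτ⟩ := hnot
  refine ⟨τ, hgτ, ?_⟩
  simp only [neg_eq_of_add_eq_zero_right hfτ, Complex.coe_algebraMap, Complex.ofReal_re]

theorem frequently_resultant_addQuadratic_ne_zero {x y : ℝ[X]} (hm : max x.natDegree 2 = m + 1)
    (hn : max y.natDegree 2 = n + 1) :
    ∃ᶠ p : ℂ × ℂ in 𝓝 0, (addQuadratic x p.1.re p.2.re).divX.resultant
      (addQuadratic y p.1.im p.2.im).divX m n ≠ 0 := by
  have hfreq : ∀ {F : Set ℝ}, F.Finite → ∃ᶠ a in 𝓝 (0 : ℝ), a ∉ F := fun hF ↦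
    mem_closure_iff_frequently.1 (hF.countable.dense_compl ℝ 0)
  intro hzero
  have hpath : Tendsto (fun q : ℝ × ℝ ↦ ((q.2 : ℂ), (⟨q.1, q.1⟩ : ℂ))) (𝓝 0 ×ˢ 𝓝 0) (𝓝 0) := by
    rw [← nhds_prod_eq]
    have hcont : Continuous fun q : ℝ × ℝ ↦ ((q.2 : ℂ), (⟨q.1, q.1⟩ : ℂ)) :=
      (Complex.continuous_ofReal.comp continuous_snd).prodMk
        (Complex.equivRealProdCLM.symm.continuous.comp (continuous_fst.prodMk continuous_fst))
    exact hcont.tendsto' _ _ rfl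
  obtain ⟨b, hb, hzero⟩ := ((hfreq (Set.toFinite {-x.coeff 2, -y.coeff 2})).and_eventually
    (hpath.eventually hzero).curry).exists
  simp only [Set.mem_insert_iff, Set.mem_singleton_iff, not_or, eq_neg_iff_add_eq_zero,
    add_comm b] at hb
  have hf (a : ℝ) : (addQuadratic x a b).divX.natDegree = m :=
    natDegree_divX_addQuadratic hm hb.1 a
  have hg : (addQuadratic y 0 b).divX.natDegree = n := natDegree_divX_addQuadratic hn hb.2 0
  have hg0 : (addQuadratic y 0 b).divX ≠ 0 := by
    intro h
    rw [h, natDegree_zero] at hg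
    omega
  obtain ⟨a, ha, hzero⟩ := ((hfreq (finite_setOf_resultant_add_C_eq_zero
    (f := (addQuadratic x 0 b).divX) hg0)).and_eventually hzero).exists
  refine hzero fun h ↦ ha ?_
  rw [Set.mem_ofPred_eq, ← divX_addQuadratic, hf, hg]
  simpa using h

end AddQuadratic

/-! ### Generic perturbations -/

theorem addHaar_image_eq_zero_of_hasLineDerivAt {E : Type*} [NormedAddCommGroup E]
    [NormedSpace ℝ E] [FiniteDimensional ℝ E] [MeasurableSpace E] [BorelSpace E] (μ : Measure E)
    [μ.IsAddHaarMeasure] {f : E → E} {A : Set E} (hf : ∀ q ∈ A, DifferentiableAt ℝ f q)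
    (hker : ∀ q ∈ A, ∃ v ≠ 0, HasLineDerivAt ℝ f 0 q v) : μ (f '' A) = 0 := by
  refine addHaar_image_eq_zero_of_det_fderivWithin_eq_zero μ
    (fun q hq ↦ (hf q hq).hasFDerivAt.hasFDerivWithinAt) fun q hq ↦ ?_
  obtain ⟨v, hv, hder⟩ := hker q hq
  rw [ContinuousLinearMap.det, LinearMap.det_eq_zero_iff_ker_ne_bot]
  have hmem : v ∈ LinearMap.ker (fderiv ℝ f q : E →ₗ[ℝ] E) :=
    ((hf q hq).hasFDerivAt.hasLineDerivAt v).unique hder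
  exact fun hbot ↦ hv (by simpa [hbot] using hmem)

theorem hasDerivAt_slope_add_mul {F : Type*} [NormedAddCommGroup F] [NormedSpace ℝ F] {Q : ℝ → F}
    {Qs Qt : F} {s t : ℝ} (hs : HasDerivAt Q Qs s) (ht : HasDerivAt Q Qt t) (hst : s ≠ t)
    (σ τ : ℝ) : HasDerivAt (fun r ↦ slope Q (s + r * σ) (t + r * τ))
      ((t - s)⁻¹ • (τ • Qt - σ • Qs - (τ - σ) • slope Q s t)) 0 := by
  have hne : t - s ≠ 0 := sub_ne_zero.2 hst.symm
  have hline (c v : ℝ) : HasDerivAt (fun r : ℝ ↦ c + r * v) v 0 := by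
    simpa using ((hasDerivAt_id (0 : ℝ)).mul_const v).const_add c
  have hcomp {c : ℝ} {q : F} (v : ℝ) (hc : HasDerivAt Q q c) :
      HasDerivAt (fun r : ℝ ↦ Q (c + r * v)) (v • q) 0 :=
    HasDerivAt.scomp (h := fun r ↦ c + r * v) 0 (by simpa using hc) (hline c v)
  have hden := ((hline t τ).sub (hline s σ)).inv (by simpa using hne)
  refine (hden.smul ((hcomp τ ht).sub (hcomp σ hs))).congr_deriv ?_
  simp only [Pi.sub_apply, Pi.inv_apply, zero_mul, add_zero, slope, vsub_eq_sub]
  match_scalars <;> field_simp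

instance : (volume : Measure (ℂ × ℂ)).IsAddHaarMeasure :=
  Measure.prod.instIsAddHaarMeasure _ _

/-- The perturbation `P(t) + a t + b t²`, where `p = (a, b)`, of a plane curve `P`. -/
def perturb (P : ℝ → ℂ) (p : ℂ × ℂ) (t : ℝ) : ℂ :=
  P t + t * p.1 + t ^ 2 * p.2

section Perturb

variable {P : ℝ → ℂ} {p : ℂ × ℂ} {s t u : ℝ}

theorem slope_perturb (hst : s ≠ t) :
    slope (perturb P p) s t = slope P s t + p.1 + (s + t) * p.2 := by
  have hne : (t : ℂ) - s ≠ 0 := sub_ne_zero.2 (Complex.ofReal_injective.ne hst.symm)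
  simp only [slope_def_module, perturb, Complex.real_smul]
  push_cast
  field_simp
  ring

theorem slope_slope_perturb (hst : s ≠ t) (hsu : s ≠ u) (htu : t ≠ u) :
    slope (slope (perturb P p) s) t u = slope (slope P s) t u + p.2 := by
  have hne : (u : ℂ) - t ≠ 0 := sub_ne_zero.2 (Complex.ofReal_injective.ne htu.symm)
  simp only [slope_def_module _ t u, slope_perturb hst, slope_perturb hsu, Complex.real_smul]
  push_cast
  field_simp
  ring

theorem hasDerivAt_perturb (hP : Differentiable ℝ P) (p : ℂ × ℂ) (t : ℝ) :
    HasDerivAt (perturb P p) (deriv P t + p.1 + 2 * t * p.2) t := by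
  have hid : HasDerivAt (fun t : ℝ ↦ (t : ℂ)) 1 t := (hasDerivAt_id t).ofReal_comp
  exact (((hP t).hasDerivAt.add (hid.mul_const p.1)).add ((hid.pow 2).mul_const p.2)).congr_deriv
    (by simp)

/-- The parameter `p = (a, b)` with the given `b = q.2` for which `perturb P p` takes the same value
at the two times `s` and `t` encoded in the complex number `q.1 = s + i t`. -/
def doubleParam (P : ℝ → ℂ) (q : ℂ × ℂ) : ℂ × ℂ :=
  (-(slope P q.1.re q.1.im + (q.1.re + q.1.im) * q.2), q.2)

theorem doubleParam_eq (hst : s ≠ t) (h : perturb P p s = perturb P p t) :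
    doubleParam P (⟨s, t⟩, p.2) = p := by
  refine Prod.ext (neg_eq_of_add_eq_zero_left ?_) rfl
  rw [← add_assoc, add_comm p.1, ← slope_perturb hst, slope_def_module, h, sub_self, smul_zero]

theorem differentiableAt_doubleParam (hP : Differentiable ℝ P) {q : ℂ × ℂ}
    (hq : q.1.re ≠ q.1.im) : DifferentiableAt ℝ (doubleParam P) q := by
  have hne : q.1.im - q.1.re ≠ 0 := sub_ne_zero.2 hq.symm
  unfold doubleParam
  simp only [slope_def_module]
  have hre : DifferentiableAt ℝ (fun q : ℂ × ℂ ↦ q.1.re) q :=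
    Complex.reCLM.differentiableAt.comp q differentiableAt_fst
  have him : DifferentiableAt ℝ (fun q : ℂ × ℂ ↦ q.1.im) q :=
    Complex.imCLM.differentiableAt.comp q differentiableAt_fst
  have hre' : DifferentiableAt ℝ (fun q : ℂ × ℂ ↦ (q.1.re : ℂ)) q :=
    Complex.ofRealCLM.differentiableAt.comp q hre
  have him' : DifferentiableAt ℝ (fun q : ℂ × ℂ ↦ (q.1.im : ℂ)) q :=
    Complex.ofRealCLM.differentiableAt.comp q him
  fun_prop (disch := assumption)

theorem hasLineDerivAt_doubleParam (hP : Differentiable ℝ P) {q : ℂ × ℂ} (hq : q.1.re ≠ q.1.im)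
    (v : ℂ) : HasLineDerivAt ℝ (doubleParam P)
      (-((q.1.im - q.1.re)⁻¹ • (v.im • deriv (perturb P (doubleParam P q)) q.1.im -
        v.re • deriv (perturb P (doubleParam P q)) q.1.re)), 0) q (v, 0) := by
  have hne : (q.1.im : ℂ) - q.1.re ≠ 0 := sub_ne_zero.2 (Complex.ofReal_injective.ne hq.symm)
  have hline (c w : ℝ) : HasDerivAt (fun r : ℝ ↦ ((c + r * w : ℝ) : ℂ)) w 0 := by
    simpa using (((hasDerivAt_id (0 : ℝ)).mul_const w).const_add c).ofReal_comp
  have hsum := ((hline q.1.re v.re).add (hline q.1.im v.im)).mul_const q.2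
  have hslope := hasDerivAt_slope_add_mul (hP q.1.re).hasDerivAt (hP q.1.im).hasDerivAt hq v.re v.im
  refine HasDerivAt.congr_deriv (f' := (_, _)) (HasDerivAt.congr_of_eventuallyEq
    ((hslope.add hsum).neg.prodMk (hasDerivAt_const (0 : ℝ) q.2))
    (Eventually.of_forall fun r ↦ by simp [doubleParam])) (Prod.ext ?_ rfl)
  simp only [(hasDerivAt_perturb hP _ _).deriv, doubleParam, Complex.real_smul]
  push_cast
  field_simp
  ring

theorem volume_image_doubleParam_eq_zero (hP : Differentiable ℝ P) : volume (doubleParam P ''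
    {q | q.1.re ≠ q.1.im ∧ ¬ LinearIndependent ℝ ![deriv (perturb P (doubleParam P q)) q.1.re,
      deriv (perturb P (doubleParam P q)) q.1.im]}) = 0 := by
  refine addHaar_image_eq_zero_of_hasLineDerivAt _
    (fun q hq ↦ differentiableAt_doubleParam hP hq.1) fun q ⟨hq, hdep⟩ ↦ ?_
  simp only [LinearIndependent.pair_iff, not_forall] at hdep
  obtain ⟨σ, τ, hστ, hne⟩ := hdep
  refine ⟨(⟨σ, -τ⟩, 0), fun h ↦ hne ?_, ?_⟩
  · simpa [Complex.ext_iff] using h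
  · have hder := hasLineDerivAt_doubleParam hP hq ⟨σ, -τ⟩
    rwa [neg_smul, ← neg_add', add_comm, hστ, neg_zero, smul_zero, neg_zero,
      Prod.mk_zero_zero] at hder

theorem ae_linearIndependent_deriv_perturb (hP : Differentiable ℝ P) :
    ∀ᵐ p, ∀ s t, s ≠ t → perturb P p s = perturb P p t →
      LinearIndependent ℝ ![deriv (perturb P p) s, deriv (perturb P p) t] := by
  filter_upwards [measure_eq_zero_iff_ae_notMem.1 (volume_image_doubleParam_eq_zero hP)]
    with p hp s t hst h
  by_contra hdep
  have hp' := doubleParam_eq hst h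
  exact hp ⟨(⟨s, t⟩, p.2), ⟨hst, hp'.symm ▸ hdep⟩, hp'⟩

theorem ae_injective_perturb_prodMk {Z : Type*} {z : ℝ → Z} (hP : Differentiable ℝ P)
    (hz : volume {q : ℂ | z q.re = z q.im} = 0) :
    ∀ᵐ p, Function.Injective fun t ↦ (perturb P p t, z t) := by
  have hnull : volume (doubleParam P '' {q | q.1.re ≠ q.1.im ∧ z q.1.re = z q.1.im}) = 0 := by
    refine addHaar_image_eq_zero_of_differentiableOn_of_addHaar_eq_zero _
      (fun q hq ↦ (differentiableAt_doubleParam hP hq.1).differentiableWithinAt) ?_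
    refine measure_mono_null (t := {q : ℂ | z q.re = z q.im} ×ˢ Set.univ)
      (fun q hq ↦ ⟨hq.2, trivial⟩) ?_
    rw [Measure.volume_eq_prod, Measure.prod_prod, hz, zero_mul]
  filter_upwards [measure_eq_zero_iff_ae_notMem.1 hnull] with p hp s t hst
  by_contra hne
  exact hp ⟨(⟨s, t⟩, p.2), ⟨hne, congrArg Prod.snd hst⟩, doubleParam_eq hne (congrArg Prod.fst hst)⟩

/-- The parameter `p` for which `perturb P p` takes the same value at the three times `s`, `t` and
`u`, where `q.1 = s + i t` and `u = re q.2`. -/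
def tripleParam (P : ℝ → ℂ) (q : ℂ × ℂ) : ℂ × ℂ :=
  doubleParam P (q.1, -slope (slope P q.1.re) q.1.im q.2.re)

theorem tripleParam_eq (hst : s ≠ t) (hsu : s ≠ u) (htu : t ≠ u)
    (ht : perturb P p s = perturb P p t) (hu : perturb P p s = perturb P p u) :
    tripleParam P (⟨s, t⟩, u) = p := by
  have hb : -slope (slope P s) t u = p.2 := by
    rw [neg_eq_iff_add_eq_zero, ← slope_slope_perturb hst hsu htu]
    simp [slope_def_module, ht, ← hu]
  rw [tripleParam, Complex.ofReal_re, hb, doubleParam_eq hst ht]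

theorem differentiableAt_tripleParam (hP : Differentiable ℝ P) {q : ℂ × ℂ}
    (hst : q.1.re ≠ q.1.im) (hsu : q.1.re ≠ q.2.re) (htu : q.1.im ≠ q.2.re) :
    DifferentiableAt ℝ (tripleParam P) q := by
  have hst' : q.1.im - q.1.re ≠ 0 := sub_ne_zero.2 hst.symm
  have hsu' : q.2.re - q.1.re ≠ 0 := sub_ne_zero.2 hsu.symm
  have htu' : q.2.re - q.1.im ≠ 0 := sub_ne_zero.2 htu.symm
  have hs : DifferentiableAt ℝ (fun q : ℂ × ℂ ↦ q.1.re) q :=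
    Complex.reCLM.differentiableAt.comp q differentiableAt_fst
  have ht : DifferentiableAt ℝ (fun q : ℂ × ℂ ↦ q.1.im) q :=
    Complex.imCLM.differentiableAt.comp q differentiableAt_fst
  have hu : DifferentiableAt ℝ (fun q : ℂ × ℂ ↦ q.2.re) q :=
    Complex.reCLM.differentiableAt.comp q differentiableAt_snd
  have hb : DifferentiableAt ℝ (fun q : ℂ × ℂ ↦ -slope (slope P q.1.re) q.1.im q.2.re) q := by
    simp only [slope_def_module]
    fun_prop (disch := assumption)
  exact DifferentiableAt.comp (g := doubleParam P) q (differentiableAt_doubleParam hP hst)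
    (differentiableAt_fst.prodMk hb)

theorem ae_perturb_eq_imp (hP : Differentiable ℝ P) :
    ∀ᵐ p, ∀ s t u, perturb P p s = perturb P p t → perturb P p s = perturb P p u →
      s = t ∨ s = u ∨ t = u := by
  have hnull : volume (tripleParam P ''
      {q | q.1.re ≠ q.1.im ∧ q.1.re ≠ q.2.re ∧ q.1.im ≠ q.2.re}) = 0 := by
    refine addHaar_image_eq_zero_of_hasLineDerivAt _
      (fun q hq ↦ differentiableAt_tripleParam hP hq.1 hq.2.1 hq.2.2) fun q _ ↦
      ⟨(0, Complex.I), by simp, ?_⟩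
    simpa [HasLineDerivAt, tripleParam] using hasDerivAt_const (0 : ℝ) (tripleParam P q)
  filter_upwards [measure_eq_zero_iff_ae_notMem.1 hnull] with p hp s t u ht hu
  by_contra! hne
  exact hp ⟨(⟨s, t⟩, u), hne, tripleParam_eq hne.1 hne.2.1 hne.2.2 ht hu⟩

end Perturb

/-- The plane curve with coordinate polynomials `x` and `y`, with values in `ℂ`. -/
def planeCurve (x y : ℝ[X]) (t : ℝ) : ℂ := ⟨x.eval t, y.eval t⟩

section PlaneCurve

variable {x y z : ℝ[X]} {m n : ℕ}

theorem contDiff_eval (x : ℝ[X]) (n : WithTop ℕ∞) : ContDiff ℝ n fun t ↦ x.eval t :=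
  x.contDiff_aeval n

theorem contDiff_planeCurve (x y : ℝ[X]) {n : WithTop ℕ∞} : ContDiff ℝ n (planeCurve x y) :=
  Complex.equivRealProdCLM.symm.contDiff.comp ((contDiff_eval x n).prodMk (contDiff_eval y n))

theorem perturb_planeCurve (x y : ℝ[X]) (p : ℂ × ℂ) : perturb (planeCurve x y) p =
    planeCurve (addQuadratic x p.1.re p.2.re) (addQuadratic y p.1.im p.2.im) := by
  ext t
  refine Complex.ext ?_ ?_ <;>
  · simp [perturb, planeCurve, addQuadratic, pow_two]
    ring

theorem isProperMap_planeCurve (hx : 0 < x.natDegree) (y : ℝ[X]) :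
    IsProperMap (planeCurve x y) := by
  refine isProperMap_iff_tendsto_cocompact.2 ⟨(contDiff_planeCurve x y (n := 0)).continuous, ?_⟩
  rw [← Metric.cobounded_eq_cocompact (α := ℂ), ← tendsto_norm_atTop_iff_cobounded]
  exact tendsto_atTop_mono (fun t ↦ Complex.abs_re_le_norm (planeCurve x y t))
    (x.tendsto_norm_atTop (natDegree_pos_iff_degree_pos.1 hx) tendsto_norm_cocompact_atTop)

theorem volume_setOf_eval_re_eq_eval_im (hz : 0 < z.natDegree) :
    volume {q : ℂ | z.eval q.re = z.eval q.im} = 0 := by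
  have hclosed : IsClosed {r : ℝ × ℝ | z.eval r.1 = z.eval r.2} :=
    isClosed_eq (by fun_prop) (by fun_prop)
  refine (Complex.volume_preserving_equiv_real_prod.measure_preimage
    hclosed.measurableSet.nullMeasurableSet).trans
    ((Measure.measure_prod_null hclosed.measurableSet).2 (Eventually.of_forall fun s ↦ ?_))
  have hne : z - C (z.eval s) ≠ 0 := fun h ↦ by
    rw [sub_eq_zero.1 h, natDegree_C] at hz
    exact hz.false
  refine ((z - C (z.eval s)).roots.toFinset.finite_toSet.subset fun t ht ↦ ?_).measure_zero _
  rw [Finset.mem_coe, Multiset.mem_toFinset, mem_roots hne, IsRoot, eval_sub, eval_C, sub_eq_zero]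
  exact Eq.symm ht

theorem exists_isRegularPlaneCurve_planeCurve (hm : m ≠ 0) (hx : x.natDegree ≤ m + 1)
    (hy : y.natDegree ≤ n + 1) (hres : x.divX.resultant y.divX m n ≠ 0)
    (htransverse : ∀ s t, s ≠ t → planeCurve x y s = planeCurve x y t →
      LinearIndependent ℝ ![deriv (planeCurve x y) s, deriv (planeCurve x y) t])
    (hdouble : ∀ s t u, planeCurve x y s = planeCurve x y t → planeCurve x y s = planeCurve x y u →
      s = t ∨ s = u ∨ t = u) :
    ∃ S : Finset ℝ, S.card ≤ m * n ∧ IsRegularPlaneCurve (planeCurve x y) S := by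
  have hR : doublePointPoly m n x y ≠ 0 := fun h ↦ hres <| by
    rw [← eval_zero_doublePointPoly, h, eval_zero]
  refine ⟨(doublePointPoly m n x y).roots.toFinset, (Multiset.toFinset_card_le _).trans
    ((card_roots' _).trans (natDegree_doublePointPoly_le hx hy)),
    contDiff_planeCurve x y, htransverse, hdouble, fun s t hst h ↦ ?_⟩
  rw [Multiset.mem_toFinset, mem_roots hR]
  exact eval_doublePointPoly_eq_zero hx hy hm hst (congrArg Complex.re h) (congrArg Complex.im h)

theorem frequently_resultant_ne_zero_and_ae (hm : max x.natDegree 2 = m + 1)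
    (hn : max y.natDegree 2 = n + 1) {Q : ℂ × ℂ → Prop} (hQ : ∀ᵐ p, Q p) :
    ∃ᶠ p : ℂ × ℂ in 𝓝 0, (addQuadratic x p.1.re p.2.re).divX.resultant
      (addQuadratic y p.1.im p.2.im).divX m n ≠ 0 ∧ Q p := by
  have hcont : Continuous fun p : ℂ × ℂ ↦ (addQuadratic x p.1.re p.2.re).divX.resultant
      (addQuadratic y p.1.im p.2.im).divX m n := by
    refine continuous_resultant (fun j ↦ ?_) (fun j ↦ ?_) m n <;>
    · simp only [coeff_divX_addQuadratic]
      split_ifs <;> fun_prop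
  rw [frequently_nhds_iff]
  intro U h0 hU
  obtain ⟨p₀, hp₀U, hp₀⟩ :=
    frequently_nhds_iff.1 (frequently_resultant_addQuadratic_ne_zero hm hn) U h0 hU
  obtain ⟨p, hpQ, hpU, hp⟩ := (Measure.dense_of_ae hQ).exists_mem_open
    (hU.inter (isOpen_ne_fun hcont continuous_const)) ⟨p₀, hp₀U, hp₀⟩
  exact ⟨p, hpU, hp, hpQ⟩

theorem frequently_isRegularPlaneCurve_perturb (hm : max x.natDegree 2 = m + 1)
    (hn : max y.natDegree 2 = n + 1) (hz : 0 < z.natDegree) :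
    ∃ᶠ p in 𝓝 0, (Function.Injective fun t ↦ (perturb (planeCurve x y) p t, z.eval t)) ∧
      IsProperMap (perturb (planeCurve x y) p) ∧
      ∃ S : Finset ℝ, S.card ≤ m * n ∧ IsRegularPlaneCurve (perturb (planeCurve x y) p) S := by
  have hm0 : m ≠ 0 := by omega
  have hP := (contDiff_planeCurve x y (n := 1)).differentiable one_ne_zero
  refine (frequently_resultant_ne_zero_and_ae hm hn
    ((ae_injective_perturb_prodMk hP (volume_setOf_eval_re_eq_eval_im hz)).and
      ((ae_linearIndependent_deriv_perturb hP).and (ae_perturb_eq_imp hP)))).mono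
    fun p ⟨hres, hinj, htransverse, hdouble⟩ ↦ ⟨hinj, ?_⟩
  simp only [perturb_planeCurve] at htransverse hdouble ⊢
  refine ⟨isProperMap_planeCurve (Nat.pos_of_ne_zero fun h ↦ hres ?_) _,
    exists_isRegularPlaneCurve_planeCurve hm0 ((natDegree_addQuadratic_le _ _ _).trans_eq hm)
      ((natDegree_addQuadratic_le _ _ _).trans_eq hn) hres htransverse hdouble⟩
  rw [eq_C_of_natDegree_eq_zero h, divX_C, resultant_zero_left, zero_pow, zero_mul]
  omega

end PlaneCurve

/-! ### Normal forms and the crossing bound -/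

section Perturb

variable {P : ℝ → ℂ} {n : ℕ} {z : ℝ[X]}

theorem eventually_norm_perturb_sub_le (P : ℝ → ℂ) {K : Set ℝ} (hK : Bornology.IsBounded K)
    {δ : ℝ} (hδ : 0 < δ) : ∀ᶠ p in 𝓝 0, ∀ s ∈ K, ∀ t ∈ K,
      ‖(perturb P p s - P s) - (perturb P p t - P t)‖ ≤ δ * |s - t| := by
  obtain ⟨R, -, hKR⟩ := hK.exists_pos_norm_le
  have hsmall : ∀ᶠ p : ℂ × ℂ in 𝓝 0, ‖p.1‖ + 2 * R * ‖p.2‖ < δ :=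
    ContinuousAt.eventually_lt (by fun_prop) continuousAt_const (by simpa using hδ)
  filter_upwards [hsmall] with p hp s hs t ht
  have hst : ‖((s + t : ℝ) : ℂ)‖ ≤ 2 * R := by
    rw [Complex.norm_real, two_mul]
    exact norm_add_le_of_le (hKR s hs) (hKR t ht)
  calc ‖(perturb P p s - P s) - (perturb P p t - P t)‖
      = ‖((s - t : ℝ) : ℂ) * (p.1 + ((s + t : ℝ) : ℂ) * p.2)‖ := by
        congr 1
        simp only [perturb]
        push_cast
        ring
    _ = ‖p.1 + ((s + t : ℝ) : ℂ) * p.2‖ * |s - t| := by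
        rw [norm_mul, Complex.norm_real, Real.norm_eq_abs, mul_comm]
    _ ≤ δ * |s - t| := by
        gcongr
        refine (norm_add_le _ _).trans (hp.le.trans' ?_)
        rw [norm_mul]
        gcongr

theorem eventually_ambientEquivalent_perturb (hk : IsEmbeddedCurve fun t ↦ (P t, z.eval t))
    (hd : 0 < z.natDegree) (hl : 0 < z.leadingCoeff) :
    ∀ᶠ p in 𝓝 0, (Function.Injective fun t ↦ (perturb P p t, z.eval t)) →
      AmbientEquivalent n (fun t ↦ (P t, z.eval t)) fun t ↦ (perturb P p t, z.eval t) := by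
  obtain ⟨T₁, T₂, hT, u, hz⟩ := exists_isStraightening n hd hl
  obtain ⟨c, hc, hlow⟩ := hk.exists_mul_abs_sub_le_norm_sub (isCompact_Icc (a := T₁) (b := T₂))
  have hP : Continuous P := hk.contDiff.continuous.fst
  obtain ⟨δ, hδ, hstable⟩ := hz.exists_forall_ambientEquivalent hP hk.injective hc hlow
  filter_upwards [eventually_norm_perturb_sub_le P (Metric.isBounded_Icc T₁ T₂) hδ] with p hp hinj
  refine hstable _ ?_ hinj hp
  unfold perturb
  fun_prop

end Perturb

/-- The curve in `ℂ × ℝ` with coordinate polynomials `x`, `y` and `z`. -/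
def polyCurve (x y z : ℝ[X]) (t : ℝ) : ℂ × ℝ := (planeCurve x y t, z.eval t)

theorem two_mul_crossingNumber_compactification_le {k : ℝ → ℂ × ℝ} {x y z : ℝ[X]}
    (hk : Function.Injective k) (hkp : AmbientEquivalent 3 k (polyCurve x y z))
    (hp : IsEmbeddedCurve (polyCurve x y z)) (hd : 0 < z.natDegree) (hl : 0 < z.leadingCoeff) :
    2 * crossingNumber (compactification k) ≤
      ((max x.natDegree 2 - 1) * (max y.natDegree 2 - 1) : ℕ) := by
  have hsub (a : ℕ) : max a 2 = max a 2 - 1 + 1 := by omega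
  obtain ⟨p, ⟨hinj, hproper, S, hS, hreg⟩, hequiv⟩ :=
    ((frequently_isRegularPlaneCurve_perturb (hsub _) (hsub _) hd).and_eventually
      (eventually_ambientEquivalent_perturb hp hd hl)).exists
  have hcont : Continuous fun t ↦ (perturb (planeCurve x y) p t, z.eval t) :=
    hproper.continuous.prodMk z.continuous
  exact (two_mul_crossingNumber_le hk (hkp.trans (hequiv hinj)) hcont hproper hreg).trans
    (Nat.cast_le.2 hS)

/-- The polynomials `x`, `y`, `z` present the curve `k`: they are the coordinates of an embedded
curve in `ℂ × ℝ` that is ambient equivalent to `k`. -/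
structure IsPresentation (k : ℝ → ℂ × ℝ) (x y z : ℝ[X]) : Prop where
  embedded : IsEmbeddedCurve (polyCurve x y z)
  equivalent : AmbientEquivalent 3 k (polyCurve x y z)

namespace IsPresentation

variable {k : ℝ → ℂ × ℝ} {x y z x' y' z' : ℝ[X]} {d : ℕ}

theorem clm_comp (h : IsPresentation k x y z) {L : ℂ × ℝ →L[ℝ] ℂ × ℝ}
    (hL : Function.Injective L)
    (hequiv : ∀ k : ℝ → ℂ × ℝ, AmbientEquivalent 3 k fun t ↦ L (k t))
    (heq : ∀ t, polyCurve x' y' z' t = L (polyCurve x y z t)) : IsPresentation k x' y' z' := by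
  have hcomp : polyCurve x' y' z' = L ∘ polyCurve x y z := funext heq
  exact ⟨hcomp ▸ h.embedded.clm_comp L hL, hcomp ▸ h.equivalent.trans (hequiv _)⟩

theorem sub_C_mul_height (h : IsPresentation k x y z) (a b : ℝ) :
    IsPresentation k (x - C a * z) (y - C b * z) z := by
  let v : ℂ := ⟨a, b⟩
  refine h.clm_comp (L := (.fst ℝ ℂ ℝ + (ContinuousLinearMap.snd ℝ ℂ ℝ).smulRight (-v)).prod
    (.snd ℝ ℂ ℝ)) (fun p q hpq ↦ ?_) (fun k ↦ ?_) fun t ↦ ?_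
  · obtain ⟨hfst, hsnd : p.2 = q.2⟩ := Prod.ext_iff.1 hpq
    exact Prod.ext (by simpa [hsnd] using hfst) hsnd
  · exact .fst_add_comp_snd (c := fun h ↦ h • (-v)) k (by fun_prop)
  · refine Prod.ext (Complex.ext ?_ ?_) rfl <;> simp [polyCurve, planeCurve, v] <;> ring

theorem add_C_mul_plane (h : IsPresentation k x y z) (a b : ℝ) :
    IsPresentation k x y (z + C a * x + C b * y) := by
  let ℓ : ℂ →L[ℝ] ℝ := a • Complex.reCLM + b • Complex.imCLM
  refine h.clm_comp (L := (ContinuousLinearMap.fst ℝ ℂ ℝ).prod (.snd ℝ ℂ ℝ + ℓ ∘L .fst ℝ ℂ ℝ))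
    (fun p q hpq ↦ ?_) (fun k ↦ ?_) fun t ↦ ?_
  · obtain ⟨hfst : p.1 = q.1, hsnd⟩ := Prod.ext_iff.1 hpq
    exact Prod.ext hfst (by simpa [hfst] using hsnd)
  · simpa using AmbientEquivalent.snd_affine_comp_fst (n := 3) k (continuous_const (y := 1))
      ℓ.continuous fun _ ↦ one_pos
  · refine Prod.ext rfl ?_
    simp [polyCurve, planeCurve, ℓ, add_assoc]

theorem rotate (h : IsPresentation k x y z) {a b : ℝ} (hab : a ≠ 0 ∨ b ≠ 0) :
    IsPresentation k (C b * x - C a * y) (C a * x + C b * y) z := by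
  let u : ℂ := ⟨b, a⟩
  have hu : u ≠ 0 := by
    rw [Ne, Complex.ext_iff]
    simpa [u, imp_iff_not_or, or_comm] using hab
  refine h.clm_comp (L := (ContinuousLinearMap.mul ℝ ℂ u).prodMap (.id ℝ ℝ)) (fun p q hpq ↦ ?_)
    (fun k ↦ ?_) fun t ↦ ?_
  · simp_all [Prod.ext_iff]
  · simpa [Prod.map, mul_comm u] using
      AmbientEquivalent.fst_mul_comp_snd (n := 3) k (continuous_const (y := u)) fun _ ↦ hu
  · refine Prod.ext (Complex.ext ?_ ?_) rfl <;> simp [polyCurve, planeCurve, u, add_comm]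

theorem exists_coeff_plane_ne_zero (h : IsPresentation k x y z) (hx : x.natDegree ≤ d)
    (hy : y.natDegree ≤ d) (hz : z.natDegree ≤ d)
    (hne : x.coeff d ≠ 0 ∨ y.coeff d ≠ 0 ∨ z.coeff d ≠ 0) :
    ∃ x' y', IsPresentation k x' y' z ∧ x'.natDegree ≤ d ∧ y'.natDegree ≤ d ∧
      (x'.coeff d ≠ 0 ∨ y'.coeff d ≠ 0) := by
  by_cases hxy : x.coeff d ≠ 0 ∨ y.coeff d ≠ 0
  · exact ⟨x, y, h, hx, hy, hxy⟩
  · have hzd : z.coeff d ≠ 0 := by tauto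
    push Not at hxy
    exact ⟨_, _, h.sub_C_mul_height 1 0,
      (natDegree_sub_le_of_le hx (by simpa)).trans_eq (max_self d), by simpa,
      .inl (by simpa [hxy.1])⟩

theorem exists_coeff_height_eq_one (h : IsPresentation k x y z) (hx : x.natDegree ≤ d)
    (hy : y.natDegree ≤ d) (hz : z.natDegree ≤ d) (hxy : x.coeff d ≠ 0 ∨ y.coeff d ≠ 0) :
    ∃ z', IsPresentation k x y z' ∧ z'.natDegree ≤ d ∧ z'.coeff d = 1 := by
  obtain ⟨a, b, hab⟩ : ∃ a b, z.coeff d + a * x.coeff d + b * y.coeff d = 1 := by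
    rcases hxy with hxd | hyd
    · exact ⟨(1 - z.coeff d) / x.coeff d, 0, by field_simp; ring⟩
    · exact ⟨0, (1 - z.coeff d) / y.coeff d, by field_simp; ring⟩
  refine ⟨_, h.add_C_mul_plane a b, ?_, by simpa using hab⟩
  compute_degree!

theorem exists_natDegree_plane_le_pred (h : IsPresentation k x y z) (hx : x.natDegree ≤ d)
    (hy : y.natDegree ≤ d) (hz : z.natDegree ≤ d) (hzd : z.coeff d = 1) :
    ∃ x' y', IsPresentation k x' y' z ∧ x'.natDegree ≤ d - 1 ∧ y'.natDegree ≤ d - 1 := by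
  have hle {p : ℝ[X]} (hp : p.natDegree ≤ d) : (p - C (p.coeff d) * z).natDegree ≤ d - 1 :=
    natDegree_le_pred ((natDegree_sub_le_of_le hp ((natDegree_C_mul_le _ z).trans hz)).trans_eq
      (max_self d)) (by simp [hzd])
  exact ⟨_, _, h.sub_C_mul_height (x.coeff d) (y.coeff d), hle hx, hle hy⟩

theorem exists_natDegree_fst_le_pred (h : IsPresentation k x y z) (hx : x.natDegree ≤ d)
    (hy : y.natDegree ≤ d) :
    ∃ x' y', IsPresentation k x' y' z ∧ x'.natDegree ≤ d - 1 ∧ y'.natDegree ≤ d := by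
  by_cases hxy : x.coeff d ≠ 0 ∨ y.coeff d ≠ 0
  · have hle {p : ℝ[X]} (hp : p.natDegree ≤ d) (a : ℝ) : (C a * p).natDegree ≤ d :=
      (natDegree_C_mul_le a p).trans hp
    exact ⟨_, _, h.rotate hxy, natDegree_le_pred ((natDegree_sub_le_of_le (hle hx _)
      (hle hy _)).trans_eq (max_self d)) (by simp [mul_comm]),
      natDegree_add_le_of_degree_le (hle hx _) (hle hy _)⟩
  · push Not at hxy
    exact ⟨x, y, h, natDegree_le_pred hx hxy.1, hy⟩

theorem exists_normalForm (h : IsPresentation k x y z) (hd : 0 < d) (hx : x.natDegree ≤ d)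
    (hy : y.natDegree ≤ d) (hz : z.natDegree ≤ d)
    (hne : x.coeff d ≠ 0 ∨ y.coeff d ≠ 0 ∨ z.coeff d ≠ 0) :
    ∃ x' y' z', IsPresentation k x' y' z' ∧ x'.natDegree ≤ d - 2 ∧ y'.natDegree ≤ d - 1 ∧
      0 < z'.natDegree ∧ 0 < z'.leadingCoeff := by
  obtain ⟨x₁, y₁, h₁, hx₁, hy₁, hne₁⟩ := h.exists_coeff_plane_ne_zero hx hy hz hne
  obtain ⟨z₂, h₂, hz₂, hz₂d⟩ := h₁.exists_coeff_height_eq_one hx₁ hy₁ hz hne₁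
  obtain ⟨x₃, y₃, h₃, hx₃, hy₃⟩ := h₂.exists_natDegree_plane_le_pred hx₁ hy₁ hz₂ hz₂d
  obtain ⟨x₄, y₄, h₄, hx₄, hy₄⟩ := h₃.exists_natDegree_fst_le_pred hx₃ hy₃
  have hdeg : z₂.natDegree = d :=
    natDegree_eq_of_le_of_coeff_ne_zero hz₂ (hz₂d ▸ one_ne_zero)
  refine ⟨x₄, y₄, z₂, h₄, hx₄, hy₄, hdeg ▸ hd, ?_⟩
  rw [leadingCoeff, hdeg, hz₂d]
  exact one_pos

theorem two_mul_crossingNumber_le (h : IsPresentation k x y z) (hd : 0 < d)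
    (hx : x.natDegree ≤ d) (hy : y.natDegree ≤ d) (hz : z.natDegree ≤ d)
    (hne : x.coeff d ≠ 0 ∨ y.coeff d ≠ 0 ∨ z.coeff d ≠ 0) :
    2 * crossingNumber (compactification k) ≤
      ((max (d - 2) 2 - 1) * (max (d - 1) 2 - 1) : ℕ) := by
  have hk : Function.Injective k := h.equivalent.symm.injective h.embedded.injective
  obtain ⟨x', y', z', h', hx', hy', hdeg, hlead⟩ := h.exists_normalForm hd hx hy hz hne
  refine (two_mul_crossingNumber_compactification_le hk h'.equivalent h'.embedded hdeg
    hlead).trans (Nat.cast_le.2 ?_)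
  gcongr

end IsPresentation

theorem coords_curve (κ : Fin 3 → ℝ[X]) (t : ℝ) :
    coords (curve κ t) = polyCurve (κ 0) (κ 1) (κ 2) t := rfl

theorem completion_eq_compactification (κ : Fin 3 → ℝ[X]) :
    completion κ = compactification (polyCurve (κ 0) (κ 1) (κ 2)) := by
  unfold completion compactification
  congr 1
  ext1 t
  simp [← coords_curve]

theorem contDiff_curve {m : ℕ} (κ : Fin m → ℝ[X]) (n : WithTop ℕ∞) : ContDiff ℝ n (curve κ) :=
  contDiff_euclidean.2 fun i ↦ contDiff_eval (κ i) n

theorem natDegree_le_degree {n : ℕ} (κ : Fin n → ℝ[X]) (i : Fin n) :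
    (κ i).natDegree ≤ degree κ :=
  Finset.le_sup (f := fun i ↦ (κ i).natDegree) (Finset.mem_univ i)

theorem exists_coeff_degree_ne_zero {n : ℕ} {κ : Fin n → ℝ[X]} (hd : 0 < degree κ) :
    ∃ i, (κ i).coeff (degree κ) ≠ 0 := by
  have : Nonempty (Fin n) := not_isEmpty_iff.1 fun _ ↦ by simp [degree] at hd
  obtain ⟨i, -, hi : degree κ = (κ i).natDegree⟩ :=
    Finset.exists_mem_eq_sup Finset.univ Finset.univ_nonempty fun i ↦ (κ i).natDegree
  refine ⟨i, ?_⟩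
  rw [hi] at hd ⊢
  exact leadingCoeff_ne_zero.2 (ne_zero_of_natDegree_gt hd)

namespace IsPolynomialKnot

theorem isEmbeddedCurve {n : ℕ} {κ : Fin n → ℝ[X]} (h : IsPolynomialKnot κ) :
    IsEmbeddedCurve (curve κ) :=
  ⟨contDiff_curve κ 1, h.injective, h.immersion⟩

theorem isPresentation {κ : Fin 3 → ℝ[X]} (h : IsPolynomialKnot κ) :
    IsPresentation (polyCurve (κ 0) (κ 1) (κ 2)) (κ 0) (κ 1) (κ 2) :=
  ⟨h.isEmbeddedCurve.clm_comp (coords : E 3 →L[ℝ] ℂ × ℝ) coords.injective, .refl _⟩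

theorem degree_pos {n : ℕ} {κ : Fin n → ℝ[X]} (h : IsPolynomialKnot κ) : 0 < degree κ := by
  by_contra hd
  have hconst (i) : (κ i).natDegree = 0 :=
    Nat.le_zero.1 ((natDegree_le_degree κ i).trans (not_lt.1 hd))
  refine zero_ne_one (h.injective (PiLp.ext fun i ↦ ?_))
  simp only [curve]
  rw [eq_C_of_natDegree_eq_zero (hconst i), eval_C, eval_C]

theorem two_mul_crossingNumber_le {κ : Fin 3 → ℝ[X]} (h : IsPolynomialKnot κ) :
    2 * crossingNumber (completion κ) ≤
      ((max (degree κ - 2) 2 - 1) * (max (degree κ - 1) 2 - 1) : ℕ) := by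
  rw [completion_eq_compactification]
  exact h.isPresentation.two_mul_crossingNumber_le h.degree_pos (natDegree_le_degree κ 0)
    (natDegree_le_degree κ 1) (natDegree_le_degree κ 2)
    (by simpa [Fin.exists_fin_succ] using exists_coeff_degree_ne_zero h.degree_pos)

end IsPolynomialKnot

theorem cast_le_of_two_mul_le {c d : ℕ} (h : 2 * c ≤ (max (d - 2) 2 - 1) * (max (d - 1) 2 - 1)) :
    (c : ℝ) ≤ 1 / 2 * ((d : ℝ) - 2) * ((d : ℝ) - 3) := by
  rcases le_or_gt d 3 with hd | hd
  · interval_cases d <;>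
    · have h' : 2 * c ≤ 1 := h
      obtain rfl : c = 0 := by omega
      norm_num
  · rw [max_eq_left (by omega), max_eq_left (by omega), Nat.sub_sub, Nat.sub_sub] at h
    have hcast : (2 * c : ℝ) ≤ (d - 3) * (d - 2) := by
      have := Nat.cast_le (α := ℝ).2 h
      push_cast [show 2 + 1 ≤ d by omega, show 1 + 1 ≤ d by omega] at this
      exact this
    linarith

end PolynomialKnots

end

theorem mainTheorem6 (κ : Fin 3 → Polynomial ℝ) (hκ : PolynomialKnots.IsPolynomialKnot κ) :
    ∃ c : ℕ, PolynomialKnots.crossingNumber (PolynomialKnots.completion κ) = (c : ℕ∞) ∧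
      (c : ℝ) ≤ 1 / 2 * ((PolynomialKnots.degree κ : ℝ) - 2) *
        ((PolynomialKnots.degree κ : ℝ) - 3) := by
  have hbound := hκ.two_mul_crossingNumber_le
  have hfinite : PolynomialKnots.crossingNumber (PolynomialKnots.completion κ) ≠ ⊤ := fun htop ↦
    ENat.natCast_ne_top _ (top_le_iff.1 (by rwa [htop, ENat.mul_top two_ne_zero] at hbound))
  obtain ⟨c, hc⟩ := ENat.ne_top_iff_exists.1 hfinite
  rw [← hc] at hbound
  exact ⟨c, hc.symm, PolynomialKnots.cast_le_of_two_mul_le (by exact_mod_cast hbound)⟩
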